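/- Let $n\ge 1$, let $\mathbb B^n=\{z\in\mathbb C^n:\|z\|<1\}$ and let $K>0$. Let $\omega=\sqrt{-1}\sum_{\alpha,\beta} g_{\alpha\bar\beta}\,dz^\alpha\wedge d\bar z^\beta$ be the complete Kähler–Einstein metric of $\mathbb B^n$ with Ricci curvature $-K$, i.e. the complete (smooth) Kähler metric on $\mathbb B^n$ with $\mathrm{Ric}(\omega)=-K\omega$. Let $\varphi:\mathbb B^n\to\mathbb R$ be a global potential of $\omega$, i.e. a smooth function with $\partial^2\varphi/\partial z^\alpha\partial\bar z^\beta=g_{\alpha\bar\beta}$ for all $\alpha,\beta$. Then $$\sup_{\mathbb B^n}|\partial\varphi|_\omega^2\ \ge\ \frac{n+1}{K},\qquad\text{where } |\partial\varphi|_\omega^2=\sum_{\alpha,\beta}g^{\alpha\bar\beta}\,\frac{\partial\varphi}{\partial z^\alpha}\,\frac{\partial\varphi}{\partial\bar z^\beta},$$ $(g^{\alpha\bar\beta})$ is the inverse of $(g_{\alpha\bar\beta})$, and the supremum is allowed to be $+\infty$. Here $\mathrm{Ric}(\omega)=\sqrt{-1}\sum R_{\alpha\bar\beta}\,dz^\alpha\wedge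 d\bar z^\beta$ with $R_{\alpha\bar\beta}=\sum g^{\lambda\bar\mu}R_{\alpha\bar\beta\lambda\bar\mu}$, where $R_{\alpha\bar\beta\lambda\bar\mu}=-\sum_{\gamma} g_{\gamma\bar\beta}\,\partial_{\bar\mu}\bigl(\sum_\delta g^{\gamma\bar\delta}\,\partial_\lambda g_{\alpha\bar\delta}\bigr)$ is the curvature tensor of $\omega$. -/

import Mathlib

open scoped ContDiff ComplexOrder

noncomputable section

namespace KahlerBall

/-- The complex Euclidean space `ℂⁿ` with its Hermitian norm. -/
abbrev Cn (n : ℕ) : Type := EuclideanSpace ℂ (Fin n)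

/-- The open unit ball of `ℂⁿ`. -/
def unitBall (n : ℕ) : Set (Cn n) := Metric.ball 0 1

/-- The `α`-th vector of the standard basis of `ℂⁿ`. -/
def stdVec {n : ℕ} (α : Fin n) : Cn n := EuclideanSpace.single α (1 : ℂ)

/-- The Wirtinger derivative `∂f/∂z^α = (∂f/∂x^α - i ∂f/∂y^α) / 2`, where `z^α = x^α + i y^α`. -/
def dz {n : ℕ} (α : Fin n) (f : Cn n → ℂ) (z : Cn n) : ℂ :=
  (fderiv ℝ f z (stdVec α) - Complex.I * fderiv ℝ f z (Complex.I • stdVec α)) / 2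

/-- The Wirtinger derivative `∂f/∂z̄^α = (∂f/∂x^α + i ∂f/∂y^α) / 2`, where `z^α = x^α + i y^α`. -/
def dzbar {n : ℕ} (α : Fin n) (f : Cn n → ℂ) (z : Cn n) : ℂ :=
  (fderiv ℝ f z (stdVec α) + Complex.I * fderiv ℝ f z (Complex.I • stdVec α)) / 2

/-- The coefficients of a real `(1,1)`-form `ω = i ∑ g_{αβ̄} dz^α ∧ dz̄^β` in the coordinates of
`ℂⁿ`: the entry `g z α β` is `g_{αβ̄}(z)`. Only the values on the domain considered matter. -/
abbrev Coeffs (n : ℕ) : Type := Cn n → Matrix (Fin n) (Fin n) ℂ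

/-- `ω = i ∑ g_{αβ̄} dz^α ∧ dz̄^β` is a (smooth) Kähler metric on the open set `Ω`: its coefficients
are smooth, `(g_{αβ̄})` is a positive definite Hermitian matrix at every point, and `dω = 0`.
As `ω` is real, `dω = 0` amounts to `∂ω = 0`, that is, `∂_γ g_{αβ̄} = ∂_α g_{γβ̄}`. -/
structure IsKahlerMetricOn {n : ℕ} (g : Coeffs n) (Ω : Set (Cn n)) : Prop where
  smooth : ∀ α β, ContDiffOn ℝ ∞ (fun z => g z α β) Ω
  posDef : ∀ z ∈ Ω, (g z).PosDef
  closed : ∀ z ∈ Ω, ∀ α β γ, dz γ (fun w => g w α β) z = dz α (fun w => g w γ β) z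

/-- The coefficients `g^{αβ̄}` of the inverse metric, with `∑_γ g^{αγ̄} g_{βγ̄} = δ^α_β`. -/
def invCoeff {n : ℕ} (g : Coeffs n) (z : Cn n) (α β : Fin n) : ℂ := (g z)⁻¹ β α

/-- The coefficients `Γ^γ_{λα} = ∑_δ g^{γδ̄} ∂_λ g_{αδ̄}` of the Kähler connection,
`∇_{∂_λ} ∂_α = ∑_γ Γ^γ_{λα} ∂_γ` (and `∇_{∂_μ̄} ∂_α = 0`). -/
def christoffel {n : ℕ} (g : Coeffs n) (γ lam α : Fin n) (z : Cn n) : ℂ :=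
  ∑ δ, invCoeff g z γ δ * dz lam (fun w => g w α δ) z

/-- The curvature coefficients `R_α^γ_{λμ̄}`, given by
`∇_{∂_λ} ∇_{∂_μ̄} ∂_α - ∇_{∂_μ̄} ∇_{∂_λ} ∂_α = ∑_γ R_α^γ_{λμ̄} ∂_γ`. The first term vanishes, so
`R_α^γ_{λμ̄} = - ∂_μ̄ Γ^γ_{λα}`. -/
def curvUp {n : ℕ} (g : Coeffs n) (α γ lam μ : Fin n) (z : Cn n) : ℂ :=
  - dzbar μ (christoffel g γ lam α) z

/-- The curvature tensor with lowered index, `R_{αβ̄λμ̄} = ∑_γ g_{γβ̄} R_α^γ_{λμ̄}`. -/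
def curv {n : ℕ} (g : Coeffs n) (α β lam μ : Fin n) (z : Cn n) : ℂ :=
  ∑ γ, g z γ β * curvUp g α γ lam μ z

/-- The Ricci curvature `R_{αβ̄} = ∑_{λ,μ} g^{λμ̄} R_{αβ̄λμ̄}`. -/
def ricci {n : ℕ} (g : Coeffs n) (α β : Fin n) (z : Cn n) : ℂ :=
  ∑ lam, ∑ μ, invCoeff g z lam μ * curv g α β lam μ z

/-- The length of the tangent vector `v = ∑ v^α ∂_α` at `z`, namely
`(∑ g_{αβ̄}(z) v^α conj(v^β))^{1/2}`. For the corresponding real tangent vector this is its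
Riemannian length up to the constant factor `√2`. -/
def vecLength {n : ℕ} (g : Coeffs n) (z v : Cn n) : ℝ :=
  Real.sqrt (∑ α, ∑ β, g z α β * v α * (starRingEnd ℂ) (v β)).re

/-- The length of a curve `γ : [0,1] → ℂⁿ`. -/
def curveLength {n : ℕ} (g : Coeffs n) (γ : ℝ → Cn n) : ENNReal :=
  ∫⁻ t in Set.Icc (0 : ℝ) 1, ENNReal.ofReal (vecLength g (γ t) (derivWithin γ (Set.Icc 0 1) t))

/-- `γ` is a `C¹` curve `[0,1] → Ω` from `x` to `y`. -/
structure IsCurveIn {n : ℕ} (Ω : Set (Cn n)) (x y : Cn n) (γ : ℝ → Cn n) : Prop where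
  contDiffOn : ContDiffOn ℝ 1 γ (Set.Icc 0 1)
  mapsTo : Set.MapsTo γ (Set.Icc 0 1) Ω
  source : γ 0 = x
  target : γ 1 = y

/-- The distance on `Ω` induced by the metric: the infimum of the lengths of the `C¹` curves in `Ω`
from `x` to `y`. -/
def metricDist {n : ℕ} (g : Coeffs n) (Ω : Set (Cn n)) (x y : Cn n) : ENNReal :=
  ⨅ (γ : ℝ → Cn n) (_ : IsCurveIn Ω x y γ), curveLength g γ

/-- The metric is complete on `Ω`: every sequence in `Ω` that is Cauchy for the induced distance
converges, for that distance, to a point of `Ω`. -/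
def IsCompleteOn {n : ℕ} (g : Coeffs n) (Ω : Set (Cn n)) : Prop :=
  ∀ u : ℕ → Cn n, (∀ k, u k ∈ Ω) →
    (∀ ε : ENNReal, 0 < ε → ∃ N, ∀ k ≥ N, ∀ l ≥ N, metricDist g Ω (u k) (u l) < ε) →
    ∃ x ∈ Ω, Filter.Tendsto (fun k => metricDist g Ω (u k) x) Filter.atTop (nhds 0)

/-- `g` is a complete Kähler–Einstein metric on `Ω` with Ricci curvature `-K`, that is,
`Ric(ω) = -K ω`. -/
structure IsCompleteKahlerEinstein {n : ℕ} (g : Coeffs n) (Ω : Set (Cn n)) (K : ℝ) : Prop where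
  kahler : IsKahlerMetricOn g Ω
  complete : IsCompleteOn g Ω
  einstein : ∀ z ∈ Ω, ∀ α β, ricci g α β z = -(K : ℂ) * g z α β

/-- `φ : Ω → ℝ` is a global potential of `ω = i ∑ g_{αβ̄} dz^α ∧ dz̄^β` on `Ω`: it is smooth and
`ddᶜ φ = i ∂∂̄ φ = ω`, that is, `∂²φ/∂z^α∂z̄^β = g_{αβ̄}`. -/
structure IsPotentialOn {n : ℕ} (g : Coeffs n) (Ω : Set (Cn n)) (φ : Cn n → ℝ) : Prop where
  smooth : ContDiffOn ℝ ∞ φ Ω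
  hessian : ∀ z ∈ Ω, ∀ α β, dz α (dzbar β (fun w => (φ w : ℂ))) z = g z α β

/-- The squared gradient length `|∂φ|²_ω = ∑ φ_α φ_β̄ g^{αβ̄}` (a real number when the matrix of
`g` is Hermitian). -/
def gradLengthSq {n : ℕ} (g : Coeffs n) (φ : Cn n → ℝ) (z : Cn n) : ℝ :=
  (∑ α, ∑ β, dz α (fun w => (φ w : ℂ)) z * dzbar β (fun w => (φ w : ℂ)) z * invCoeff g z α β).re

end KahlerBall

end

/-! ### Wirtinger calculus. -/

noncomputable section

namespace KahlerBall

variable {n : ℕ}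

/-! Suppose `|∂φ|² ≤ A` on the ball with `K A < n + 1`. The contradiction comes from one divergence
identity, integrated against Lebesgue measure. Two facts make this possible: the weight `e^{θφ}` has
finite integral when `θ A < 1`, and completeness supplies cutoffs with small gradient.

Integrability (`integrableOn_exp_potential`). Since `∂∂̄ e^{-φ/A} = e^{-φ/A} (∂φ ∧ ∂̄φ / A² - ∂∂̄φ /
A)`, the gradient bound says that `e^{-φ/A}` is plurisuperharmonic. It is positive, so a Hopf
barrier gives `e^{-φ/A} ≥ c (1 - ‖z‖)` near the sphere. Hence `e^{θφ} ≤ C (1 - ‖z‖)^{-θA}`, which is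
integrable for `0 ≤ θ` and `θ A < 1`.

Divergence (`sum_dzbar_testField`, `re_sum_dzbar_testField_le`). Let `a_α = ∑_γ Γ^γ_{αγ}`, which is
`∂_α log det g`. The trace of the Einstein equation is `∑ g^{αβ̄} ∂_β̄ a_α = K n`. For `W^β = e^{θφ}
∑_α g^{αβ̄} (a_α - c ∂_α φ)` with `c = θ + 2s`, put `Y = a - (θ + s) ∂φ`. Then the real part of `∑_β
∂_β̄ W^β` equals `e^{θφ} ((K - θ - 2s) n - |Y|² + s² |∂φ|²)`. Bounding `|∂φ|²` by `A` and taking `s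
= n / A`, the constant becomes `n (K - θ - n / A)`. It is negative when `θ > K - n / A`. This is
compatible with `θ < 1 / A` exactly because `K A < n + 1`.

Cutoff (`IsKahlerMetricOn.isCompact_metricBall`, `exists_lipschitzWith_metricCutoff`). By Hopf-Rinow
the metric balls are compact in the Euclidean ball, so a piecewise linear function `ζ` of the
distance to `0` is Lipschitz with compact support and satisfies `|dζ| ≤ 1 / R`. The divergence of
`ζ² W` integrates to zero. The cross term `2ζ ∂̄ζ · W` is absorbed by `-ζ² |Y|²` up to an error `O(1
/ R) e^{θφ}` (`re_sum_dzbar_cutoff_sq_mul_le`), so no bound on `a` is needed. As `R` grows, the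
integral of `ζ² e^{θφ}` is forced to zero, although it is bounded below by the integral over a fixed
small ball. -/

theorem isOpen_unitBall : IsOpen (unitBall n) := Metric.isOpen_ball

section Wirtinger

variable {f h : Cn n → ℂ} {z : Cn n} {Ω : Set (Cn n)}

theorem dzbar_congr (hfh : f =ᶠ[nhds z] h) (α : Fin n) : dzbar α f z = dzbar α h z := by
  simp only [dzbar, hfh.fderiv_eq]

theorem dzbar_const (c : ℂ) (α : Fin n) : dzbar α (fun _ : Cn n => c) z = 0 := by
  simp [dzbar]

theorem dzbar_mul (hf : DifferentiableAt ℝ f z) (hh : DifferentiableAt ℝ h z) (α : Fin n) :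
    dzbar α (fun w => f w * h w) z = f z * dzbar α h z + dzbar α f z * h z := by
  simp only [dzbar, fderiv_fun_mul hf hh, _root_.add_apply,
    _root_.smul_apply, smul_eq_mul]; ring

theorem dzbar_sub (hf : DifferentiableAt ℝ f z) (hh : DifferentiableAt ℝ h z) (α : Fin n) :
    dzbar α (fun w => f w - h w) z = dzbar α f z - dzbar α h z := by
  simp only [dzbar, fderiv_fun_sub hf hh, _root_.sub_apply]; ring

theorem dzbar_const_mul (hf : DifferentiableAt ℝ f z) (c : ℂ) (α : Fin n) :
    dzbar α (fun w => c * f w) z = c * dzbar α f z := by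
  simp only [dzbar, fderiv_const_mul hf c, _root_.smul_apply, smul_eq_mul]; ring

theorem dzbar_sum {ι : Type*} (s : Finset ι) {F : ι → Cn n → ℂ}
    (hF : ∀ i ∈ s, DifferentiableAt ℝ (F i) z) (α : Fin n) :
    dzbar α (fun w => ∑ i ∈ s, F i w) z = ∑ i ∈ s, dzbar α (F i) z := by
  simp only [dzbar, fderiv_fun_sum hF, _root_.sum_apply, Finset.mul_sum,
    ← Finset.sum_add_distrib, Finset.sum_div]

theorem dzbar_conj (α : Fin n) :
    dzbar α (fun w => (starRingEnd ℂ) (f w)) z = (starRingEnd ℂ) (dz α f z) := by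
  have : fderiv ℝ (fun w => (starRingEnd ℂ) (f w)) z
      = (Complex.conjCLE : ℂ →L[ℝ] ℂ).comp (fderiv ℝ f z) :=
    Complex.conjCLE.comp_fderiv (f := f) (x := z)
  simp [dz, dzbar, this, Complex.conj_I, map_ofNat]

theorem dzbar_ofReal (u : Cn n → ℝ) (α : Fin n) :
    dzbar α (fun w => (u w : ℂ)) z = (starRingEnd ℂ) (dz α (fun w => (u w : ℂ)) z) := by
  rw [← dzbar_conj]; simp

theorem dzbar_cexp (hf : DifferentiableAt ℝ f z) (α : Fin n) :
    dzbar α (fun w => Complex.exp (f w)) z = Complex.exp (f z) * dzbar α f z := by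
  have := (hf.hasFDerivAt.cexp).fderiv
  simp only [dzbar, this, _root_.smul_apply, smul_eq_mul]; ring

theorem contDiffOn_dz (hΩ : IsOpen Ω) (hf : ContDiffOn ℝ ∞ f Ω) (α : Fin n) :
    ContDiffOn ℝ ∞ (dz α f) Ω := by
  have h1 : ContDiffOn ℝ ∞ (fderiv ℝ f) Ω := hf.fderiv_of_isOpen hΩ (by simp)
  unfold dz
  exact ((h1.clm_apply contDiffOn_const).sub
    (contDiffOn_const.mul (h1.clm_apply contDiffOn_const))).div_const _

theorem differentiableAt_of_contDiffOn (hΩ : IsOpen Ω) (hf : ContDiffOn ℝ ∞ f Ω) (hz : z ∈ Ω) :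
    DifferentiableAt ℝ f z :=
  (hf.contDiffAt (hΩ.mem_nhds hz)).differentiableAt (by simp)

theorem fderiv_fderiv_apply_eq (hΩ : IsOpen Ω) (hf : ContDiffOn ℝ ∞ f Ω) (hz : z ∈ Ω)
    (v : Cn n) : fderiv ℝ (fun w => fderiv ℝ f w v) z
      = (fderiv ℝ (fderiv ℝ f) z).flip v := by
  have h1 : DifferentiableAt ℝ (fderiv ℝ f) z :=
    ((hf.fderiv_of_isOpen hΩ (m := ∞) (by simp)).contDiffAt
      (hΩ.mem_nhds hz)).differentiableAt (by simp)
  ext u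
  rw [fderiv_clm_apply h1 (differentiableAt_const v)]
  simp

/-- Expansion into the real second derivative, the form in which the symmetry of that derivative and
its restriction to real lines can be used. -/
theorem dz_dzbar_eq (hΩ : IsOpen Ω) (hf : ContDiffOn ℝ ∞ f Ω) (hz : z ∈ Ω) (α β : Fin n) :
    dz α (dzbar β f) z =
      (fderiv ℝ (fderiv ℝ f) z (stdVec α) (stdVec β)
        + Complex.I * fderiv ℝ (fderiv ℝ f) z (stdVec α) (Complex.I • stdVec β)
        - Complex.I * fderiv ℝ (fderiv ℝ f) z (Complex.I • stdVec α) (stdVec β)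
        + fderiv ℝ (fderiv ℝ f) z (Complex.I • stdVec α) (Complex.I • stdVec β)) / 4 := by
  have h1 : ContDiffOn ℝ ∞ (fderiv ℝ f) Ω := hf.fderiv_of_isOpen hΩ (by simp)
  have hd : ∀ v, DifferentiableAt ℝ (fun w => fderiv ℝ f w v) z := fun v =>
    ((h1.clm_apply contDiffOn_const).contDiffAt (hΩ.mem_nhds hz)).differentiableAt (by simp)
  have h2 : fderiv ℝ (dzbar β f) z = (2 : ℂ)⁻¹ • (fderiv ℝ (fun w => fderiv ℝ f w (stdVec β)) z
      + Complex.I • fderiv ℝ (fun w => fderiv ℝ f w (Complex.I • stdVec β)) z) := by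
    have : dzbar β f = fun w => (2 : ℂ)⁻¹ * (fderiv ℝ f w (stdVec β)
      + Complex.I * fderiv ℝ f w (Complex.I • stdVec β)) := by
      ext w; simp only [dzbar]; ring
    rw [this, fderiv_const_mul ((hd _).fun_add ((hd _).const_mul _)),
      fderiv_fun_add (hd _) ((hd _).const_mul _), fderiv_const_mul (hd _)]
  simp only [dz, h2, fderiv_fderiv_apply_eq hΩ hf hz, _root_.smul_apply,
    _root_.add_apply, ContinuousLinearMap.flip_apply, smul_eq_mul]
  linear_combination (-1/4 : ℂ) * (fderiv ℝ (fderiv ℝ f) z (Complex.I • stdVec α))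
    (Complex.I • stdVec β) * Complex.I_sq

theorem dzbar_dz_eq (hΩ : IsOpen Ω) (hf : ContDiffOn ℝ ∞ f Ω) (hz : z ∈ Ω) (α β : Fin n) :
    dzbar β (dz α f) z = dz α (dzbar β f) z := by
  have h1 : ContDiffOn ℝ ∞ (fderiv ℝ f) Ω := hf.fderiv_of_isOpen hΩ (by simp)
  have hd : ∀ v, DifferentiableAt ℝ (fun w => fderiv ℝ f w v) z := fun v =>
    ((h1.clm_apply contDiffOn_const).contDiffAt (hΩ.mem_nhds hz)).differentiableAt (by simp)
  have h2 : fderiv ℝ (dz α f) z = (2 : ℂ)⁻¹ • (fderiv ℝ (fun w => fderiv ℝ f w (stdVec α)) z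
      - Complex.I • fderiv ℝ (fun w => fderiv ℝ f w (Complex.I • stdVec α)) z) := by
    have : dz α f = fun w => (2 : ℂ)⁻¹ * (fderiv ℝ f w (stdVec α)
      - Complex.I * fderiv ℝ f w (Complex.I • stdVec α)) := by
      ext w; simp only [dz]; ring
    rw [this, fderiv_const_mul ((hd _).fun_sub ((hd _).const_mul _)),
      fderiv_fun_sub (hd _) ((hd _).const_mul _), fderiv_const_mul (hd _)]
  have hs : IsSymmSndFDerivAt ℝ f z :=
    (hf.contDiffAt (hΩ.mem_nhds hz)).isSymmSndFDerivAt
      (by rw [minSmoothness_of_isRCLikeNormedField]; exact WithTop.coe_le_coe.2 (le_top : (2 : ℕ∞) ≤ ⊤))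
  rw [dz_dzbar_eq hΩ hf hz]
  simp only [dzbar, h2, fderiv_fderiv_apply_eq hΩ hf hz, _root_.smul_apply,
    _root_.sub_apply, ContinuousLinearMap.flip_apply, smul_eq_mul]
  rw [hs.eq (stdVec β) (stdVec α), hs.eq (stdVec β), hs.eq (Complex.I • stdVec β) (stdVec α),
    hs.eq (Complex.I • stdVec β)]
  linear_combination (-1/4 : ℂ) * (fderiv ℝ (fderiv ℝ f) z (Complex.I • stdVec α))
    (Complex.I • stdVec β) * Complex.I_sq

end Wirtinger

end KahlerBall

end

/-! ### Kähler identities, the dual Hermitian form and the divergence of the test field. -/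

noncomputable section

namespace KahlerBall

variable {n : ℕ}

theorem contDiffOn_det {E : Type*} [NormedAddCommGroup E] [NormedSpace ℝ E] {s : Set E}
    {M : E → Matrix (Fin n) (Fin n) ℂ}
    (hM : ∀ i j, ContDiffOn ℝ ∞ (fun z => M z i j) s) :
    ContDiffOn ℝ ∞ (fun z => (M z).det) s := by
  simp only [Matrix.det_apply']
  exact ContDiffOn.sum fun σ _ => contDiffOn_const.mul (contDiffOn_prod fun i _ => hM _ _)

section Kahler

variable {g : Coeffs n} {Ω : Set (Cn n)} {z : Cn n}

theorem IsKahlerMetricOn.isUnit_det (hk : IsKahlerMetricOn g Ω) (hz : z ∈ Ω) :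
    IsUnit (g z).det :=
  (Matrix.isUnit_iff_isUnit_det _).1 (hk.posDef z hz).isUnit

theorem IsKahlerMetricOn.conj_apply (hk : IsKahlerMetricOn g Ω) (hz : z ∈ Ω) (α β : Fin n) :
    (starRingEnd ℂ) (g z α β) = g z β α :=
  (hk.posDef z hz).isHermitian.apply β α

theorem IsKahlerMetricOn.conj_invCoeff (hk : IsKahlerMetricOn g Ω) (hz : z ∈ Ω) (α β : Fin n) :
    (starRingEnd ℂ) (invCoeff g z α β) = invCoeff g z β α :=
  (hk.posDef z hz).inv.isHermitian.apply α β

theorem IsKahlerMetricOn.contDiffOn_invCoeff (hk : IsKahlerMetricOn g Ω) (α β : Fin n) :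
    ContDiffOn ℝ ∞ (fun z => invCoeff g z α β) Ω := by
  simp only [invCoeff, Matrix.inv_def, Ring.inverse_eq_inv', Matrix.smul_apply, smul_eq_mul,
    Matrix.adjugate_apply]
  refine ContDiffOn.mul ?_ (contDiffOn_det fun i j => ?_)
  · exact (contDiffOn_det hk.smooth).inv fun z hz => (hk.isUnit_det hz).ne_zero
  · simp only [Matrix.updateRow_apply]
    split_ifs
    · exact contDiffOn_const
    · exact hk.smooth i j

/-- The trace `∑_α Γ^α_{λα}` of the connection coefficients. -/
def traceConn (g : Coeffs n) (lam : Fin n) (z : Cn n) : ℂ := ∑ α, christoffel g α lam α z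

theorem IsKahlerMetricOn.contDiffOn_christoffel (hk : IsKahlerMetricOn g Ω) (hΩ : IsOpen Ω)
    (γ lam α : Fin n) : ContDiffOn ℝ ∞ (christoffel g γ lam α) Ω := by
  unfold christoffel
  exact ContDiffOn.sum fun δ _ =>
    (hk.contDiffOn_invCoeff γ δ).mul (contDiffOn_dz hΩ (hk.smooth α δ) lam)

theorem IsKahlerMetricOn.contDiffOn_traceConn (hk : IsKahlerMetricOn g Ω) (hΩ : IsOpen Ω)
    (lam : Fin n) : ContDiffOn ℝ ∞ (traceConn g lam) Ω := by
  unfold traceConn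
  exact ContDiffOn.sum fun α _ => hk.contDiffOn_christoffel hΩ α lam α

/-- Conjugate form of the Kähler condition. -/
theorem IsKahlerMetricOn.dzbar_comm (hk : IsKahlerMetricOn g Ω) (hΩ : IsOpen Ω) (hz : z ∈ Ω)
    (α β γ : Fin n) :
    dzbar γ (fun w => g w α β) z = dzbar β (fun w => g w α γ) z := by
  have h : ∀ β γ, dzbar γ (fun w => g w α β) z
      = (starRingEnd ℂ) (dz γ (fun w => g w β α) z) := fun β γ => by
    rw [← dzbar_conj]
    refine dzbar_congr ?_ γ
    filter_upwards [hΩ.mem_nhds hz] with w hw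
    exact (hk.conj_apply hw β α).symm
  rw [h, h, hk.closed z hz β α γ]

theorem IsKahlerMetricOn.conj_traceConn (hk : IsKahlerMetricOn g Ω) (hΩ : IsOpen Ω) (hz : z ∈ Ω)
    (lam : Fin n) : (starRingEnd ℂ) (traceConn g lam z)
      = ∑ α, ∑ δ, invCoeff g z δ α * dzbar lam (fun w => g w δ α) z := by
  simp only [traceConn, christoffel, map_sum, map_mul, hk.conj_invCoeff hz]
  refine Finset.sum_congr rfl fun α _ => Finset.sum_congr rfl fun δ _ => ?_
  rw [← dzbar_conj]
  congr 1
  refine dzbar_congr ?_ lam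
  filter_upwards [hΩ.mem_nhds hz] with w hw
  exact hk.conj_apply hw α δ

theorem IsKahlerMetricOn.sum_invCoeff_mul (hk : IsKahlerMetricOn g Ω) (hz : z ∈ Ω)
    (α β : Fin n) : ∑ γ, invCoeff g z γ β * g z γ α = if β = α then 1 else 0 := by
  have := congrFun (congrFun (Matrix.nonsing_inv_mul (g z) (hk.isUnit_det hz)) β) α
  rwa [Matrix.mul_apply, Matrix.one_apply] at this

theorem IsKahlerMetricOn.sum_mul_invCoeff (hk : IsKahlerMetricOn g Ω) (hz : z ∈ Ω)
    (α β : Fin n) : ∑ γ, g z α γ * invCoeff g z β γ = if α = β then 1 else 0 := by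
  have := congrFun (congrFun (Matrix.mul_nonsing_inv (g z) (hk.isUnit_det hz)) α) β
  rwa [Matrix.mul_apply, Matrix.one_apply] at this

/-- The usual `∂̄(g⁻¹) = -g⁻¹ (∂̄g) g⁻¹`: differentiate the identity `g⁻¹ g = 1`, which holds near
`z`, and multiply by `g⁻¹` on the right. -/
theorem IsKahlerMetricOn.dzbar_invCoeff (hk : IsKahlerMetricOn g Ω) (hΩ : IsOpen Ω)
    (hz : z ∈ Ω) (α β μ : Fin n) :
    dzbar μ (fun w => invCoeff g w α β) z
      = - ∑ δ, (∑ γ, invCoeff g z γ β * dzbar μ (fun w => g w γ δ) z) * invCoeff g z α δ := by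
  have hI : ∀ a b, DifferentiableAt ℝ (fun w => invCoeff g w a b) z := fun a b =>
    differentiableAt_of_contDiffOn hΩ (hk.contDiffOn_invCoeff a b) hz
  have hG : ∀ a b, DifferentiableAt ℝ (fun w => g w a b) z := fun a b =>
    differentiableAt_of_contDiffOn hΩ (hk.smooth a b) hz
  have key : ∀ δ, ∑ γ, dzbar μ (fun w => invCoeff g w γ β) z * g z γ δ
      = - ∑ γ, invCoeff g z γ β * dzbar μ (fun w => g w γ δ) z := fun δ => by
    have h0 : dzbar μ (fun w => ∑ γ, invCoeff g w γ β * g w γ δ) z = 0 := by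
      rw [← dzbar_const (z := z) (if β = δ then 1 else 0) μ]
      refine dzbar_congr ?_ μ
      filter_upwards [hΩ.mem_nhds hz] with w hw
      exact hk.sum_invCoeff_mul hw δ β
    rw [dzbar_sum _ fun γ _ => (hI γ β).fun_mul (hG γ δ)] at h0
    simp only [dzbar_mul (hI _ _) (hG _ _), Finset.sum_add_distrib] at h0
    linear_combination h0
  calc dzbar μ (fun w => invCoeff g w α β) z
      = ∑ γ, dzbar μ (fun w => invCoeff g w γ β) z * (if γ = α then 1 else 0) := by simp
    _ = ∑ γ, dzbar μ (fun w => invCoeff g w γ β) z * ∑ δ, g z γ δ * invCoeff g z α δ := by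
        simp only [hk.sum_mul_invCoeff hz]
    _ = ∑ δ, (∑ γ, dzbar μ (fun w => invCoeff g w γ β) z * g z γ δ) * invCoeff g z α δ := by
        simp only [Finset.mul_sum, Finset.sum_mul]
        rw [Finset.sum_comm]
        simp only [mul_assoc]
    _ = _ := by simp only [key, neg_mul, Finset.sum_neg_distrib]

/-- On a Kähler manifold `∑_β ∂_β̄ g^{αβ̄} = -∑_β g^{αβ̄} conj (∑_γ Γ^γ_{βγ})`. -/
theorem IsKahlerMetricOn.sum_dzbar_invCoeff (hk : IsKahlerMetricOn g Ω) (hΩ : IsOpen Ω)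
    (hz : z ∈ Ω) (α : Fin n) :
    ∑ β, dzbar β (fun w => invCoeff g w α β) z
      = - ∑ β, invCoeff g z α β * (starRingEnd ℂ) (traceConn g β z) := by
  simp only [hk.dzbar_invCoeff hΩ hz, hk.conj_traceConn hΩ hz, Finset.sum_neg_distrib, neg_inj]
  rw [Finset.sum_comm]
  refine Finset.sum_congr rfl fun δ _ => ?_
  rw [← Finset.sum_mul, mul_comm]
  congr 1
  refine Finset.sum_congr rfl fun β _ => Finset.sum_congr rfl fun γ _ => ?_
  rw [hk.dzbar_comm hΩ hz]

/-- The trace of the Einstein equation. -/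
theorem IsKahlerMetricOn.sum_dzbar_traceConn (hk : IsKahlerMetricOn g Ω) (hΩ : IsOpen Ω)
    (hz : z ∈ Ω) {K : ℝ} (hE : ∀ α β, ricci g α β z = -(K : ℂ) * g z α β) :
    ∑ lam, ∑ μ, invCoeff g z lam μ * dzbar μ (traceConn g lam) z = K * n := by
  have hc : ∀ γ lam α, DifferentiableAt ℝ (christoffel g γ lam α) z := fun γ lam α =>
    differentiableAt_of_contDiffOn hΩ (hk.contDiffOn_christoffel hΩ γ lam α) hz
  have h1 : ∑ α, ∑ β, invCoeff g z α β * ricci g α β z = -(K * n) := by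
    simp only [hE]
    calc ∑ α, ∑ β, invCoeff g z α β * (-(K : ℂ) * g z α β)
        = -K * ∑ α, ∑ β, g z α β * invCoeff g z α β := by
          simp only [Finset.mul_sum]
          refine Finset.sum_congr rfl fun α _ => Finset.sum_congr rfl fun β _ => ?_
          ring
      _ = _ := by simp [hk.sum_mul_invCoeff hz]
  have h2 : ∑ α, ∑ β, invCoeff g z α β * ricci g α β z
      = - ∑ lam, ∑ μ, invCoeff g z lam μ * dzbar μ (traceConn g lam) z := by
    -- Only the scalar curvature is needed. Contracting `α, β` before `λ, μ` cancels the lowered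
    -- index and leaves `-∂_μ̄ Γ^α_{λα}`, so no symmetry of the curvature tensor is used.
    have h3 : ∀ lam μ α, ∑ β, invCoeff g z α β * curv g α β lam μ z
        = - dzbar μ (christoffel g α lam α) z := fun lam μ α => by
      simp only [curv, curvUp, Finset.mul_sum]
      rw [Finset.sum_comm]
      calc _ = ∑ γ, (∑ β, g z γ β * invCoeff g z α β) * -dzbar μ (christoffel g γ lam α) z := by
            refine Finset.sum_congr rfl fun γ _ => ?_
            rw [Finset.sum_mul]
            exact Finset.sum_congr rfl fun β _ => by ring
        _ = _ := by simp [hk.sum_mul_invCoeff hz]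
    have h4 : ∀ lam μ, dzbar μ (traceConn g lam) z
        = ∑ α, dzbar μ (christoffel g α lam α) z := fun lam μ => by
      unfold traceConn
      exact dzbar_sum _ (fun α _ => hc α lam α) μ
    calc ∑ α, ∑ β, invCoeff g z α β * ricci g α β z
        = ∑ α, ∑ lam, ∑ μ, invCoeff g z lam μ * ∑ β, invCoeff g z α β * curv g α β lam μ z := by
          refine Finset.sum_congr rfl fun α _ => ?_
          simp only [ricci, Finset.mul_sum]
          rw [Finset.sum_comm]
          refine Finset.sum_congr rfl fun lam _ => ?_
          rw [Finset.sum_comm]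
          exact Finset.sum_congr rfl fun μ _ => Finset.sum_congr rfl fun β _ => by ring
      _ = _ := by
          simp only [h3, h4, Finset.mul_sum, mul_neg, Finset.sum_neg_distrib, neg_inj]
          rw [Finset.sum_comm]
          refine Finset.sum_congr rfl fun lam _ => ?_
          rw [Finset.sum_comm]
  linear_combination h2 - h1

/-- The Hermitian form `∑ g^{αβ̄} u_α conj (w_β)` on covectors. -/
def coForm (g : Coeffs n) (z : Cn n) (u w : Fin n → ℂ) : ℂ :=
  ∑ α, ∑ β, invCoeff g z α β * u α * (starRingEnd ℂ) (w β)

theorem coForm_eq (u w : Fin n → ℂ) :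
    coForm g z u w = star w ⬝ᵥ ((g z)⁻¹.mulVec u) := by
  simp only [coForm, dotProduct, Matrix.mulVec, Finset.mul_sum, invCoeff]
  rw [Finset.sum_comm]
  refine Finset.sum_congr rfl fun β _ => Finset.sum_congr rfl fun α _ => ?_
  simp only [Pi.star_apply, RCLike.star_def]; ring

theorem IsKahlerMetricOn.coForm_self_nonneg (hk : IsKahlerMetricOn g Ω) (hz : z ∈ Ω)
    (u : Fin n → ℂ) : 0 ≤ (coForm g z u u).re := by
  rw [coForm_eq]
  exact (hk.posDef z hz).inv.posSemidef.re_dotProduct_nonneg u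

theorem IsKahlerMetricOn.conj_coForm (hk : IsKahlerMetricOn g Ω) (hz : z ∈ Ω)
    (u w : Fin n → ℂ) : (starRingEnd ℂ) (coForm g z u w) = coForm g z w u := by
  simp only [coForm, map_sum, map_mul, hk.conj_invCoeff hz, Complex.conj_conj]
  rw [Finset.sum_comm]
  exact Finset.sum_congr rfl fun β _ => Finset.sum_congr rfl fun α _ => by ring

theorem coForm_add_left (u u' w : Fin n → ℂ) :
    coForm g z (fun α => u α + u' α) w = coForm g z u w + coForm g z u' w := by
  simp only [coForm, mul_add, add_mul, Finset.sum_add_distrib]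

theorem coForm_smul_left (c : ℂ) (u w : Fin n → ℂ) :
    coForm g z (fun α => c * u α) w = c * coForm g z u w := by
  simp only [coForm, Finset.mul_sum]
  exact Finset.sum_congr rfl fun β _ => Finset.sum_congr rfl fun α _ => by ring

theorem IsKahlerMetricOn.coForm_add_right (hk : IsKahlerMetricOn g Ω) (hz : z ∈ Ω)
    (u w w' : Fin n → ℂ) :
    coForm g z u (fun α => w α + w' α) = coForm g z u w + coForm g z u w' := by
  rw [← hk.conj_coForm hz, coForm_add_left, map_add, hk.conj_coForm hz, hk.conj_coForm hz]

theorem IsKahlerMetricOn.coForm_real_smul_right (hk : IsKahlerMetricOn g Ω) (hz : z ∈ Ω)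
    (c : ℝ) (u w : Fin n → ℂ) :
    coForm g z u (fun α => c * w α) = c * coForm g z u w := by
  rw [← hk.conj_coForm hz, coForm_smul_left, map_mul, hk.conj_coForm hz, Complex.conj_ofReal]

/-- `Re h(u - v, u + v) = h(u, u) - h(v, v)`. -/
theorem IsKahlerMetricOn.re_coForm_sub_add (hk : IsKahlerMetricOn g Ω) (hz : z ∈ Ω)
    (c : ℝ) (u v : Fin n → ℂ) :
    (coForm g z (fun α => u α + ((-c : ℝ) : ℂ) * v α) (fun α => u α + (c : ℂ) * v α)).re
      = (coForm g z u u).re - c ^ 2 * (coForm g z v v).re := by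
  rw [coForm_add_left, hk.coForm_add_right hz, hk.coForm_add_right hz, coForm_smul_left,
    coForm_smul_left, hk.coForm_real_smul_right hz, hk.coForm_real_smul_right hz,
    ← hk.conj_coForm hz u v]
  simp only [Complex.add_re, Complex.re_ofReal_mul, Complex.conj_re]
  ring

/-- The parallelogram law with the nonnegative term `|u + c v|²` dropped. -/
theorem IsKahlerMetricOn.re_coForm_add_le (hk : IsKahlerMetricOn g Ω) (hz : z ∈ Ω)
    (c : ℝ) (u v : Fin n → ℂ) :
    (coForm g z (fun α => u α + ((-c : ℝ) : ℂ) * v α) (fun α => u α + ((-c : ℝ) : ℂ) * v α)).re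
      ≤ 2 * (coForm g z u u).re + 2 * c ^ 2 * (coForm g z v v).re := by
  have h := hk.coForm_self_nonneg hz (fun α => u α + (c : ℂ) * v α)
  rw [coForm_add_left, hk.coForm_add_right hz, hk.coForm_add_right hz, coForm_smul_left,
    coForm_smul_left, hk.coForm_real_smul_right hz, hk.coForm_real_smul_right hz] at h ⊢
  simp only [Complex.add_re, Complex.re_ofReal_mul] at h ⊢
  nlinarith

theorem IsPotentialOn.contDiffOn_ofReal {φ : Cn n → ℝ} (hφ : IsPotentialOn g Ω φ) :
    ContDiffOn ℝ ∞ (fun w => (φ w : ℂ)) Ω :=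
  Complex.ofRealCLM.contDiff.comp_contDiffOn hφ.smooth

/-- The covector `∂φ`. -/
def delta (φ : Cn n → ℝ) (z : Cn n) (α : Fin n) : ℂ := dz α (fun w => (φ w : ℂ)) z

theorem gradLengthSq_eq (φ : Cn n → ℝ) :
    gradLengthSq g φ z = (coForm g z (delta φ z) (delta φ z)).re := by
  simp only [gradLengthSq, coForm, dzbar_ofReal, delta]
  congr 1
  exact Finset.sum_congr rfl fun β _ => Finset.sum_congr rfl fun α _ => by ring

/-- The field `e^{θφ} ∑_α g^{αβ̄} (a_α - c ∂_α φ)`, where `a` is the trace of the connection. -/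
def testField (g : Coeffs n) (φ : Cn n → ℝ) (θ c : ℝ) (β : Fin n) (z : Cn n) : ℂ :=
  Complex.exp (θ * φ z) * ∑ α, invCoeff g z α β * (traceConn g α z - c * delta φ z α)

theorem contDiffOn_testField (hΩ : IsOpen Ω) (hk : IsKahlerMetricOn g Ω) {φ : Cn n → ℝ}
    (hφ : IsPotentialOn g Ω φ) (θ c : ℝ) (β : Fin n) :
    ContDiffOn ℝ ∞ (testField g φ θ c β) Ω := by
  unfold testField
  refine ContDiffOn.mul (contDiffOn_const.mul hφ.contDiffOn_ofReal).cexp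
    (ContDiffOn.sum fun α _ => (hk.contDiffOn_invCoeff α β).mul
      ((hk.contDiffOn_traceConn hΩ α).sub (contDiffOn_const.mul ?_)))
  exact contDiffOn_dz hΩ hφ.contDiffOn_ofReal α

/-- With `f = a - c ∂φ`, the product rule gives four contributions. The derivative of `a` gives `K
n` by the traced Einstein equation. The derivative of `∂φ` gives `-c n`, because the complex Hessian
of `φ` is `g`. The derivative of `g⁻¹` gives `-⟨f, a⟩` by the Kähler condition, and that of the
exponential gives `θ ⟨f, ∂φ⟩`. -/
theorem sum_dzbar_testField (hΩ : IsOpen Ω) (hk : IsKahlerMetricOn g Ω) {φ : Cn n → ℝ}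
    (hφ : IsPotentialOn g Ω φ) {K : ℝ} (hz : z ∈ Ω)
    (hE : ∀ α β, ricci g α β z = -(K : ℂ) * g z α β) (θ c : ℝ) :
    ∑ β, dzbar β (testField g φ θ c β) z = Complex.exp (θ * φ z) *
      ((K - c) * n - coForm g z (fun α => traceConn g α z - c * delta φ z α)
        (fun α => traceConn g α z - θ * delta φ z α)) := by
  have hI : ∀ a b, DifferentiableAt ℝ (fun w => invCoeff g w a b) z := fun a b =>
    differentiableAt_of_contDiffOn hΩ (hk.contDiffOn_invCoeff a b) hz
  have hφd : DifferentiableAt ℝ (fun w => (φ w : ℂ)) z :=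
    differentiableAt_of_contDiffOn hΩ hφ.contDiffOn_ofReal hz
  have hT : ∀ α, DifferentiableAt ℝ (traceConn g α) z := fun α =>
    differentiableAt_of_contDiffOn hΩ (hk.contDiffOn_traceConn hΩ α) hz
  have hD : ∀ α, DifferentiableAt ℝ (fun w => delta φ w α) z := fun α =>
    differentiableAt_of_contDiffOn hΩ (contDiffOn_dz hΩ hφ.contDiffOn_ofReal α) hz
  have hF : ∀ α, DifferentiableAt ℝ (fun w => traceConn g α w - c * delta φ w α) z := fun α =>
    (hT α).fun_sub ((hD α).const_mul _)
  have hexp : DifferentiableAt ℝ (fun w => Complex.exp (θ * φ w)) z := (hφd.const_mul _).cexp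
  have hdF : ∀ α β, dzbar β (fun w => traceConn g α w - c * delta φ w α) z
      = dzbar β (traceConn g α) z - c * g z α β := fun α β => by
    rw [dzbar_sub (hT α) ((hD α).const_mul _), dzbar_const_mul (hD α), ← hφ.hessian z hz,
      ← dzbar_dz_eq hΩ hφ.contDiffOn_ofReal hz]
    rfl
  have hdexp : ∀ β, dzbar β (fun w => Complex.exp (θ * φ w)) z
      = Complex.exp (θ * φ z) * (θ * (starRingEnd ℂ) (delta φ z β)) := fun β => by
    rw [dzbar_cexp (hφd.const_mul _), dzbar_const_mul hφd, dzbar_ofReal]; rfl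
  have hW : ∀ β, dzbar β (testField g φ θ c β) z = Complex.exp (θ * φ z) *
      (∑ α, invCoeff g z α β * dzbar β (traceConn g α) z
        - c * ∑ α, g z α β * invCoeff g z α β
        + ∑ α, dzbar β (fun w => invCoeff g w α β) z * (traceConn g α z - c * delta φ z α)
        + ∑ α, invCoeff g z α β * (traceConn g α z - c * delta φ z α)
            * (θ * (starRingEnd ℂ) (delta φ z β))) := fun β => by
    unfold testField
    rw [dzbar_mul hexp (DifferentiableAt.fun_sum fun α _ => (hI α β).fun_mul (hF α)), hdexp,
      dzbar_sum _ fun α _ => (hI α β).fun_mul (hF α)]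
    simp only [dzbar_mul (hI _ _) (hF _), hdF]
    rw [mul_assoc, ← mul_add]
    congr 1
    simp only [Finset.mul_sum, ← Finset.sum_add_distrib, ← Finset.sum_sub_distrib]
    exact Finset.sum_congr rfl fun α _ => by ring
  simp only [hW, ← Finset.mul_sum, Finset.sum_add_distrib, Finset.sum_sub_distrib]
  congr 1
  have e1 : ∑ β, ∑ α, invCoeff g z α β * dzbar β (traceConn g α) z = K * n := by
    rw [Finset.sum_comm]; exact hk.sum_dzbar_traceConn hΩ hz hE
  have e2 : ∑ β, ∑ α, g z α β * invCoeff g z α β = n := by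
    rw [Finset.sum_comm]; simp [hk.sum_mul_invCoeff hz]
  have e3 : ∑ β, ∑ α, dzbar β (fun w => invCoeff g w α β) z
        * (traceConn g α z - c * delta φ z α)
      = - ∑ β, ∑ α, invCoeff g z α β * (traceConn g α z - c * delta φ z α)
          * (starRingEnd ℂ) (traceConn g β z) := by
    rw [Finset.sum_comm]
    conv_rhs => rw [Finset.sum_comm, ← Finset.sum_neg_distrib]
    refine Finset.sum_congr rfl fun α _ => ?_
    rw [← Finset.sum_mul, hk.sum_dzbar_invCoeff hΩ hz, neg_mul, Finset.sum_mul]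
    exact congrArg _ (Finset.sum_congr rfl fun β _ => by ring)
  have e4 : coForm g z (fun α => traceConn g α z - c * delta φ z α)
        (fun α => traceConn g α z - θ * delta φ z α)
      = ∑ β, ∑ α, invCoeff g z α β * (traceConn g α z - c * delta φ z α)
          * (starRingEnd ℂ) (traceConn g β z)
        - ∑ β, ∑ α, invCoeff g z α β * (traceConn g α z - c * delta φ z α)
            * (θ * (starRingEnd ℂ) (delta φ z β)) := by
    simp only [coForm]
    rw [Finset.sum_comm]
    simp only [← Finset.sum_sub_distrib, map_sub, map_mul, Complex.conj_ofReal]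
    exact Finset.sum_congr rfl fun α _ => Finset.sum_congr rfl fun β _ => by ring
  rw [e1, e2, e3, e4]
  ring

/-- The real part of the divergence of the test field is bounded above when `|∂φ|² ≤ A`. -/
theorem re_sum_dzbar_testField_le (hΩ : IsOpen Ω) (hk : IsKahlerMetricOn g Ω) {φ : Cn n → ℝ}
    (hφ : IsPotentialOn g Ω φ) {K A : ℝ} (hA : gradLengthSq g φ z ≤ A) (hz : z ∈ Ω)
    (hE : ∀ α β, ricci g α β z = -(K : ℂ) * g z α β) (θ s : ℝ) :
    (∑ β, dzbar β (testField g φ θ (θ + 2 * s) β) z).re ≤ Real.exp (θ * φ z) *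
      ((K - θ - 2 * s) * n + s ^ 2 * A
        - (coForm g z (fun α => traceConn g α z - (θ + s) * delta φ z α)
        (fun α => traceConn g α z - (θ + s) * delta φ z α)).re) := by
  rw [sum_dzbar_testField hΩ hk hφ hz hE, ← Complex.ofReal_mul, ← Complex.ofReal_exp,
    Complex.re_ofReal_mul]
  refine mul_le_mul_of_nonneg_left ?_ (Real.exp_pos _).le
  -- The two arguments of the form are `Y - s ∂φ` and `Y + s ∂φ`, where the midpoint is `Y = a - (θ
  -- + s) ∂φ`. This is the reason for writing the coefficient `c` as `θ + 2s`.
  have h := hk.re_coForm_sub_add hz s (fun α => traceConn g α z - (θ + s) * delta φ z α)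
    (delta φ z)
  have h1 : (fun α => traceConn g α z - (θ + s) * delta φ z α + ((-s : ℝ) : ℂ) * delta φ z α)
      = fun α => traceConn g α z - ((θ + 2 * s : ℝ) : ℂ) * delta φ z α := by
    ext α; push_cast; ring
  have h2 : (fun α => traceConn g α z - (θ + s) * delta φ z α + (s : ℂ) * delta φ z α)
      = fun α => traceConn g α z - (θ : ℂ) * delta φ z α := by
    ext α; ring
  rw [h1, h2] at h
  rw [Complex.sub_re, h, ← gradLengthSq_eq]
  have h3 : (((K : ℂ) - ((θ + 2 * s : ℝ) : ℂ)) * n).re = (K - θ - 2 * s) * n := by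
    rw [← Complex.ofReal_sub, Complex.re_ofReal_mul, Complex.natCast_re]; ring
  rw [h3]
  nlinarith [mul_le_mul_of_nonneg_left hA (sq_nonneg s)]

end Kahler

end KahlerBall

end

/-! ### Complex and real Hessians, and Cauchy-Schwarz for the metric. -/

noncomputable section

namespace KahlerBall

variable {n : ℕ}

theorem sum_smul_stdVec (v : Cn n) : ∑ α, v α • stdVec α = v := by
  have := (EuclideanSpace.basisFun (Fin n) ℂ).sum_repr v
  simpa [stdVec] using this

/-- The `ℂ`-linear part of a real linear form, in coordinates. -/
theorem apply_sub_I_mul_apply (L : Cn n →L[ℝ] ℂ) (v : Cn n) :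
    L v - Complex.I * L (Complex.I • v)
      = ∑ α, v α * (L (stdVec α) - Complex.I * L (Complex.I • stdVec α)) := by
  have hs : ∀ (c : ℂ) (w : Cn n), L (c • w) = c.re * L w + c.im * L (Complex.I • w) := by
    intro c w
    have : c • w = c.re • w + c.im • (Complex.I • w) := by
      conv_lhs => rw [← Complex.re_add_im c]
      rw [add_smul, mul_smul, Complex.coe_smul, Complex.coe_smul]
    rw [this, map_add, map_smul, map_smul]
    simp
  let T : Cn n →ₗ[ℂ] ℂ :=
    { toFun := fun w => L w - Complex.I * L (Complex.I • w)
      map_add' := fun a b => by simp only [smul_add, map_add]; ring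
      map_smul' := fun c w => by
        simp only [RingHom.id_apply, smul_eq_mul]
        rw [smul_comm Complex.I c w, hs c w, hs c (Complex.I • w), smul_smul Complex.I,
          Complex.I_mul_I, neg_one_smul, map_neg]
        nth_rewrite 5 [← Complex.re_add_im c]
        linear_combination (c.im * L (Complex.I • w)) * Complex.I_sq }
  change T v = ∑ α, v α * T (stdVec α)
  conv_lhs => rw [← sum_smul_stdVec v]
  simp only [map_sum, map_smul, smul_eq_mul]

theorem apply_add_I_mul_apply (L : Cn n →L[ℝ] ℂ) (v : Cn n) :
    L v + Complex.I * L (Complex.I • v)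
      = ∑ α, (starRingEnd ℂ) (v α) * (L (stdVec α) + Complex.I * L (Complex.I • stdVec α)) := by
  have h := congrArg (starRingEnd ℂ)
    (apply_sub_I_mul_apply ((Complex.conjCLE : ℂ →L[ℝ] ℂ).comp L) v)
  simpa [sub_eq_add_neg, Complex.conj_I] using h

section

variable {Ω : Set (Cn n)} {φ : Cn n → ℝ} {z : Cn n} {g : Coeffs n}

theorem fderiv_ofReal_comp (hφ : DifferentiableAt ℝ φ z) (v : Cn n) :
    fderiv ℝ (fun w => (φ w : ℂ)) z v = fderiv ℝ φ z v := by
  have : fderiv ℝ (fun w => (φ w : ℂ)) z = Complex.ofRealCLM.comp (fderiv ℝ φ z) :=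
    (Complex.ofRealCLM.hasFDerivAt.comp z hφ.hasFDerivAt).fderiv
  rw [this]; simp

theorem sum_dz_ofReal_mul (hφ : DifferentiableAt ℝ φ z) (v : Cn n) :
    ∑ α, dz α (fun w => (φ w : ℂ)) z * v α
      = (fderiv ℝ φ z v - Complex.I * fderiv ℝ φ z (Complex.I • v)) / 2 := by
  rw [← fderiv_ofReal_comp hφ, ← fderiv_ofReal_comp hφ, apply_sub_I_mul_apply, Finset.sum_div]
  exact Finset.sum_congr rfl fun α _ => by rw [dz]; ring

theorem fderiv_fderiv_ofReal_comp (hΩ : IsOpen Ω) (hφ : ContDiffOn ℝ ∞ φ Ω) (hz : z ∈ Ω)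
    (u v : Cn n) :
    fderiv ℝ (fderiv ℝ (fun w => (φ w : ℂ))) z u v = fderiv ℝ (fderiv ℝ φ) z u v := by
  have h1 : DifferentiableAt ℝ (fderiv ℝ φ) z :=
    ((hφ.fderiv_of_isOpen hΩ (m := ∞) (by simp)).contDiffAt
      (hΩ.mem_nhds hz)).differentiableAt (by simp)
  have hF : ContDiffOn ℝ ∞ (fun w => (φ w : ℂ)) Ω :=
    Complex.ofRealCLM.contDiff.comp_contDiffOn hφ
  have h2 := congrArg (fun L => L u) (fderiv_fderiv_apply_eq hΩ hF hz v)
  simp only [ContinuousLinearMap.flip_apply] at h2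
  rw [← h2]
  have h3 : (fun w => fderiv ℝ (fun w => (φ w : ℂ)) w v)
      =ᶠ[nhds z] fun w => ((fderiv ℝ φ w v : ℝ) : ℂ) := by
    filter_upwards [hΩ.mem_nhds hz] with w hw
    exact fderiv_ofReal_comp ((hφ.contDiffAt (hΩ.mem_nhds hw)).differentiableAt (by simp)) v
  rw [h3.fderiv_eq, fderiv_ofReal_comp (h1.clm_apply (differentiableAt_const v)),
    fderiv_clm_apply h1 (differentiableAt_const v)]
  simp

/-- The Hermitian form `∑ g_{αβ̄} v^α conj (v^β)`. -/
def vecForm (g : Coeffs n) (z v : Cn n) : ℂ :=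
  ∑ α, ∑ β, g z α β * v α * (starRingEnd ℂ) (v β)

/-- The complex Hessian is the sum of two real second derivatives. -/
theorem IsPotentialOn.re_vecForm (hφ : IsPotentialOn g Ω φ) (hΩ : IsOpen Ω) (hz : z ∈ Ω)
    (v : Cn n) : 4 * (vecForm g z v).re = fderiv ℝ (fderiv ℝ φ) z v v
      + fderiv ℝ (fderiv ℝ φ) z (Complex.I • v) (Complex.I • v) := by
  set F : Cn n → ℂ := fun w => (φ w : ℂ)
  have hF : ContDiffOn ℝ ∞ F Ω := hφ.contDiffOn_ofReal
  set B := fderiv ℝ (fderiv ℝ F) z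
  have hs : IsSymmSndFDerivAt ℝ F z := (hF.contDiffAt (hΩ.mem_nhds hz)).isSymmSndFDerivAt
    (by
      rw [minSmoothness_of_isRCLikeNormedField]
      exact WithTop.coe_le_coe.2 (le_top : (2 : ℕ∞) ≤ ⊤))
  have key : B v v + B (Complex.I • v) (Complex.I • v) = 4 * vecForm g z v := by
    have e1 := apply_add_I_mul_apply (B v) v
    have e2 := apply_add_I_mul_apply (B (Complex.I • v)) v
    -- The right side applies the `∂` combination in the first slot and the `∂̄` combination in the
    -- second. The mixed terms it introduces cancel by symmetry of `B`.
    have e3 : B v v + B (Complex.I • v) (Complex.I • v)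
        = (B v v + Complex.I * B v (Complex.I • v))
          - Complex.I * (B (Complex.I • v) v
            + Complex.I * B (Complex.I • v) (Complex.I • v)) := by
      rw [hs.eq v (Complex.I • v)]
      linear_combination (B (Complex.I • v) (Complex.I • v)) * Complex.I_sq
    rw [e3, e1, e2, Finset.mul_sum, ← Finset.sum_sub_distrib]
    have hd := fun α β => (hφ.hessian z hz α β).symm.trans (dz_dzbar_eq hΩ hF hz α β)
    simp only [vecForm, hd]
    rw [Finset.sum_comm, Finset.mul_sum]
    refine Finset.sum_congr rfl fun β _ => ?_
    have f1 := apply_sub_I_mul_apply (B.flip (stdVec β)) v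
    have f2 := apply_sub_I_mul_apply (B.flip (Complex.I • stdVec β)) v
    simp only [ContinuousLinearMap.flip_apply] at f1 f2
    calc _ = (starRingEnd ℂ) (v β) * ((B v (stdVec β)
              - Complex.I * B (Complex.I • v) (stdVec β))
            + Complex.I * (B v (Complex.I • stdVec β)
              - Complex.I * B (Complex.I • v) (Complex.I • stdVec β))) := by ring
      _ = _ := by
        rw [f1, f2, Finset.mul_sum, ← Finset.sum_add_distrib, Finset.mul_sum, Finset.mul_sum]
        refine Finset.sum_congr rfl fun α _ => ?_
        linear_combination (-(starRingEnd ℂ) (v β) * v α *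
          B (Complex.I • stdVec α) (Complex.I • stdVec β)) * Complex.I_sq
  have := congrArg Complex.re key
  simp only [B, F, fderiv_fderiv_ofReal_comp hΩ hφ.smooth hz, Complex.add_re,
    Complex.ofReal_re] at this
  rw [this]
  simp

/-- Lowering the index of a vector. -/
def lower (g : Coeffs n) (z v : Cn n) (β : Fin n) : ℂ := ∑ γ, g z β γ * (starRingEnd ℂ) (v γ)

theorem IsKahlerMetricOn.coForm_lower (hk : IsKahlerMetricOn g Ω) (hz : z ∈ Ω) (u : Fin n → ℂ)
    (v : Cn n) : coForm g z u (lower g z v) = ∑ α, u α * v α := by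
  simp only [coForm, lower, map_sum, map_mul, hk.conj_apply hz, Complex.conj_conj]
  refine Finset.sum_congr rfl fun α _ => ?_
  calc _ = u α * ∑ γ, (∑ β, g z γ β * invCoeff g z α β) * v γ := by
        simp only [Finset.mul_sum, Finset.sum_mul]
        rw [Finset.sum_comm]
        exact Finset.sum_congr rfl fun γ _ => Finset.sum_congr rfl fun β _ => by ring
    _ = _ := by simp [hk.sum_mul_invCoeff hz]

theorem IsKahlerMetricOn.coForm_lower_lower (hk : IsKahlerMetricOn g Ω) (hz : z ∈ Ω)
    (v : Cn n) : coForm g z (lower g z v) (lower g z v) = vecForm g z v := by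
  rw [hk.coForm_lower hz]
  simp only [lower, vecForm, Finset.sum_mul]
  exact Finset.sum_congr rfl fun α _ => Finset.sum_congr rfl fun β _ => by ring

/-- Cauchy-Schwarz inequality between vectors and covectors. -/
theorem IsKahlerMetricOn.normSq_pairing_le (hk : IsKahlerMetricOn g Ω) (hz : z ∈ Ω) {A : ℝ}
    (hA : 0 < A) {u : Fin n → ℂ} (hu : (coForm g z u u).re ≤ A) (v : Cn n) :
    Complex.normSq (∑ α, u α * v α) ≤ A * (vecForm g z v).re := by
  set p := ∑ α, u α * v α with hp
  set w := lower g z v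
  have h1 : coForm g z u w = p := hk.coForm_lower hz u v
  -- The Cauchy-Schwarz test covector, with the upper bound `A` in the place of `|u|²`. It stays
  -- usable when `u = 0`, and the only division is by `A > 0`.
  have h0 := hk.coForm_self_nonneg hz
    (fun α => (A : ℂ) * w α + (-(starRingEnd ℂ) p) * u α)
  have h2 : coForm g z w u = (starRingEnd ℂ) p := by rw [← h1, hk.conj_coForm hz]
  have h3 : ∀ x, coForm g z x (fun α => (-(starRingEnd ℂ) p) * u α) = -p * coForm g z x u := by
    intro x
    rw [← hk.conj_coForm hz, coForm_smul_left, map_mul, hk.conj_coForm hz]; simp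
  rw [coForm_add_left, coForm_smul_left, coForm_smul_left, hk.coForm_add_right hz,
    hk.coForm_add_right hz, hk.coForm_real_smul_right hz, hk.coForm_real_smul_right hz,
    h3, h3, h1, h2, hk.coForm_lower_lower hz] at h0
  have h4 : (A : ℂ) * ((A : ℂ) * vecForm g z v + -p * (starRingEnd ℂ) p)
        + -(starRingEnd ℂ) p * ((A : ℂ) * p + -p * coForm g z u u)
      = ((A * A : ℝ) : ℂ) * vecForm g z v - ((2 * A * Complex.normSq p : ℝ) : ℂ)
        + ((Complex.normSq p : ℝ) : ℂ) * coForm g z u u := by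
    push_cast
    rw [← Complex.mul_conj p]; ring
  rw [h4, Complex.add_re, Complex.sub_re, Complex.re_ofReal_mul, Complex.re_ofReal_mul,
    Complex.ofReal_re] at h0
  have h5 := mul_le_mul_of_nonneg_left hu (Complex.normSq_nonneg p)
  have h6 : A * Complex.normSq p ≤ A * (A * (vecForm g z v).re) := by nlinarith
  exact le_of_mul_le_mul_left h6 hA

theorem vecLength_eq (v : Cn n) : vecLength g z v = Real.sqrt (vecForm g z v).re := rfl

end

end KahlerBall

end

/-! ### The Hopf barrier and the integrability of `e^{θφ}`. -/

noncomputable section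

namespace KahlerBall

variable {n : ℕ}

/-- Necessary second order condition at a local minimum. -/
theorem nonneg_of_isLocalMin_of_hasDerivAt {h h' : ℝ → ℝ} {h2 x : ℝ} (hmin : IsLocalMin h x)
    (hd : ∀ᶠ t in nhds x, HasDerivAt h (h' t) t) (hd2 : HasDerivAt h' h2 x) : 0 ≤ h2 := by
  by_contra! hneg
  have hdd : deriv h =ᶠ[nhds x] h' := hd.mono fun t ht => ht.deriv
  have e2 : deriv (deriv h) x = h2 := by rw [hdd.deriv_eq, hd2.deriv]
  -- A negative second derivative would make `x` a local maximum as well. Then `h` is locally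
  -- constant and its second derivative is zero.
  have hmax : IsLocalMax h x := isLocalMax_of_deriv_deriv_neg (by rw [e2]; exact hneg)
    hmin.deriv_eq_zero hd.self_of_nhds.continuousAt
  have hconst : h =ᶠ[nhds x] fun _ => h x := by
    filter_upwards [hmin, hmax] with t h1 h3 using le_antisymm h3 h1
  have h0 : deriv h =ᶠ[nhds x] fun _ => 0 := by
    filter_upwards [hconst.eventuallyEq_nhds] with t ht
    rw [ht.deriv_eq]; simp
  have : deriv (deriv h) x = 0 := by rw [h0.deriv_eq]; simp
  linarith

section

variable {Ω : Set (Cn n)} {φ : Cn n → ℝ} {z : Cn n} {g : Coeffs n}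

/-- The second derivative of `e^{-φ/A}` along a real line is computed from `φ`. The barrier enters
only through its restriction `r` to that line, which is explicit in the directions used later. -/
theorem second_variation_exp_sub (hΩ : IsOpen Ω) (hφ : ContDiffOn ℝ ∞ φ Ω) (hz : z ∈ Ω)
    (A c : ℝ) (v : Cn n) {r r' : ℝ → ℝ} {r2 : ℝ}
    (hr : ∀ᶠ t in nhds 0, HasDerivAt r (r' t) t) (hr2 : HasDerivAt r' r2 0)
    (hmin : IsLocalMin (fun t : ℝ => Real.exp (-φ (z + t • v) / A) - c * r t) 0) :
    0 ≤ Real.exp (-φ z / A) * ((fderiv ℝ φ z v) ^ 2 / A ^ 2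
      - fderiv ℝ (fderiv ℝ φ) z v v / A) - c * r2 := by
  have hγ : ∀ t : ℝ, HasDerivAt (fun t : ℝ => z + t • v) v t := fun t => by
    simpa using ((hasDerivAt_id t).smul_const v).const_add z
  have hmem : ∀ᶠ t : ℝ in nhds 0, z + t • v ∈ Ω := by
    have : Filter.Tendsto (fun t : ℝ => z + t • v) (nhds 0) (nhds z) := by
      simpa using (hγ 0).continuousAt.tendsto
    exact this.eventually (hΩ.mem_nhds hz)
  have h1 : ∀ w ∈ Ω, HasFDerivAt φ (fderiv ℝ φ w) w := fun w hw =>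
    ((hφ.contDiffAt (hΩ.mem_nhds hw)).differentiableAt (by simp)).hasFDerivAt
  have h2 : HasFDerivAt (fderiv ℝ φ) (fderiv ℝ (fderiv ℝ φ) z) z :=
    (((hφ.fderiv_of_isOpen hΩ (m := ∞) (by simp)).contDiffAt
      (hΩ.mem_nhds hz)).differentiableAt (by simp)).hasFDerivAt
  have hφt : ∀ t : ℝ, z + t • v ∈ Ω →
      HasDerivAt (fun t : ℝ => φ (z + t • v)) (fderiv ℝ φ (z + t • v) v) t := fun t ht =>
    (h1 _ ht).comp_hasDerivAt t (hγ t)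
  have hexp : ∀ t : ℝ, z + t • v ∈ Ω →
      HasDerivAt (fun t : ℝ => Real.exp (-φ (z + t • v) / A))
        (Real.exp (-φ (z + t • v) / A) * (-fderiv ℝ φ (z + t • v) v / A)) t := fun t ht =>
    ((hφt t ht).neg.div_const A).exp
  have hz0 : z + (0 : ℝ) • v ∈ Ω := by simpa using hz
  have hφ2 : HasDerivAt (fun t : ℝ => fderiv ℝ φ (z + t • v) v)
      (fderiv ℝ (fderiv ℝ φ) z v v) 0 := by
    have h3 : HasFDerivAt (fun w => fderiv ℝ φ w v)
        ((ContinuousLinearMap.apply ℝ ℝ v).comp (fderiv ℝ (fderiv ℝ φ) z)) z :=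
      (ContinuousLinearMap.apply ℝ ℝ v).hasFDerivAt.comp z h2
    exact h3.comp_hasDerivAt_of_eq (0 : ℝ) (hγ 0) (by simp)
  have key := nonneg_of_isLocalMin_of_hasDerivAt hmin
    (h' := fun t => Real.exp (-φ (z + t • v) / A) * (-fderiv ℝ φ (z + t • v) v / A) - c * r' t)
    (h2 := _) ?_ (((hexp 0 hz0).mul (hφ2.neg.div_const A)).sub (hr2.const_mul c))
  · simp only [Pi.neg_apply, zero_smul, add_zero] at key
    convert key using 1
    ring
  · filter_upwards [hmem, hr] with t ht htr using (hexp t ht).sub (htr.const_mul c)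

/-- The barrier comparison underlying the Hopf lemma: `e^{-φ/A}` is plurisuperharmonic. -/
theorem exp_neg_div_nonneg_of_isMin (hΩ : IsOpen Ω) (hk : IsKahlerMetricOn g Ω)
    (hφ : IsPotentialOn g Ω φ) (hz : z ∈ Ω) {A c : ℝ} (hA : 0 < A) (hc : 0 < c)
    (hgrad : gradLengthSq g φ z ≤ A) (hz0 : z ≠ 0) {b : ℝ}
    (hmin : IsLocalMin (fun w => Real.exp (-φ w / A) - c * ((‖w‖ ^ 2)⁻¹ - b)) z) : False := by
  have hN : 0 < ‖z‖ := norm_pos_iff.2 hz0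
  have hline : ∀ v : Cn n, IsLocalMin (fun t : ℝ => Real.exp (-φ (z + t • v) / A)
      - c * ((‖z + t • v‖ ^ 2)⁻¹ - b)) 0 := fun v => by
    have hcont : ContinuousAt (fun t : ℝ => z + t • v) 0 := by fun_prop
    have h0 : z + (0 : ℝ) • v = z := by simp
    have h1 : Filter.Tendsto (fun t : ℝ => z + t • v) (nhds 0) (nhds z) := by
      simpa only [h0] using hcont.tendsto
    rw [← h0] at hmin
    exact IsMinFilter.comp_tendsto (g := fun t : ℝ => z + t • v) hmin (by rwa [h0])
  -- Only the complex line through `0` and `z` is tested, in the directions `z` and `i z`. There the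
  -- barrier restricts to `(1 + t)⁻² ‖z‖⁻²` and `(1 + t²)⁻¹ ‖z‖⁻²`, with second derivatives `6 /
  -- ‖z‖²` and `-2 / ‖z‖²` at `0`. Their sum is positive, so the barrier is strictly subharmonic on
  -- this line, while `e^{-φ/A}` is superharmonic there.
  have k1 : 0 ≤ Real.exp (-φ z / A) * ((fderiv ℝ φ z z) ^ 2 / A ^ 2
      - fderiv ℝ (fderiv ℝ φ) z z z / A) - c * (6 / ‖z‖ ^ 2) := by
    refine second_variation_exp_sub hΩ hφ.smooth hz A c z
      (r := fun t => ((1 + t) ^ 2)⁻¹ * (‖z‖ ^ 2)⁻¹ - b)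
      (r' := fun t => -(2 * (1 + t)) / ((1 + t) ^ 2) ^ 2 * (‖z‖ ^ 2)⁻¹) ?_ ?_ ?_
    · have : ∀ᶠ t : ℝ in nhds 0, 1 + t ≠ 0 := by
        have : ContinuousAt (fun t : ℝ => 1 + t) 0 := by fun_prop
        exact this.eventually_ne (by simp)
      filter_upwards [this] with t ht
      have h1 : HasDerivAt (fun t : ℝ => (1 + t) ^ 2) (2 * (1 + t)) t := by
        simpa using ((hasDerivAt_id t).const_add 1).fun_pow 2
      exact ((h1.inv (pow_ne_zero 2 ht)).mul_const _).sub_const _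
    · have h1 : HasDerivAt (fun t : ℝ => -(2 * (1 + t))) (-(2 * 1)) 0 :=
        (((hasDerivAt_id (0 : ℝ)).const_add 1).const_mul 2).neg
      have h2 : HasDerivAt (fun t : ℝ => ((1 + t) ^ 2) ^ 2) (4 : ℝ) 0 := by
        have := (((hasDerivAt_id (0 : ℝ)).const_add 1).pow 2).pow 2
        convert! this using 1
        norm_num
      have h3 := (h1.div h2 (by norm_num)).mul_const (‖z‖ ^ 2)⁻¹
      convert! h3 using 1
      field_simp
      norm_num
    · refine (hline z).congr (Filter.Eventually.of_forall fun t => ?_)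
      have : z + t • z = (1 + t) • z := by rw [add_smul, one_smul]
      simp only [this, norm_smul, mul_pow, Real.norm_eq_abs, sq_abs, mul_inv]
  have k2 : 0 ≤ Real.exp (-φ z / A) * ((fderiv ℝ φ z (Complex.I • z)) ^ 2 / A ^ 2
      - fderiv ℝ (fderiv ℝ φ) z (Complex.I • z) (Complex.I • z) / A) - c * (-2 / ‖z‖ ^ 2) := by
    refine second_variation_exp_sub hΩ hφ.smooth hz A c (Complex.I • z)
      (r := fun t => (1 + t ^ 2)⁻¹ * (‖z‖ ^ 2)⁻¹ - b)
      (r' := fun t => -(2 * t) / (1 + t ^ 2) ^ 2 * (‖z‖ ^ 2)⁻¹) ?_ ?_ ?_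
    · refine Filter.Eventually.of_forall fun t => ?_
      have h1 : HasDerivAt (fun t : ℝ => 1 + t ^ 2) (2 * t) t := by
        simpa using ((hasDerivAt_id t).fun_pow 2).const_add 1
      exact ((h1.inv (by positivity)).mul_const _).sub_const _
    · have h1 : HasDerivAt (fun t : ℝ => -(2 * t)) (-(2 * 1)) 0 :=
        ((hasDerivAt_id (0 : ℝ)).const_mul 2).neg
      have h2 : HasDerivAt (fun t : ℝ => (1 + t ^ 2) ^ 2) (0 : ℝ) 0 := by
        have := (((hasDerivAt_id (0 : ℝ)).pow 2).const_add 1).pow 2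
        convert! this using 1
        norm_num
      have h3 := (h1.div h2 (by norm_num)).mul_const (‖z‖ ^ 2)⁻¹
      convert! h3 using 1
      field_simp
      norm_num
    · refine (hline (Complex.I • z)).congr (Filter.Eventually.of_forall fun t => ?_)
      have h1 : z + t • Complex.I • z = ((1 : ℝ) + t * Complex.I : ℂ) • z := by
        rw [add_smul, mul_smul, Complex.coe_smul, Complex.coe_smul, one_smul]
      have h2 : ‖((1 : ℝ) + t * Complex.I : ℂ)‖ ^ 2 = 1 + t ^ 2 := by
        rw [← Complex.normSq_eq_norm_sq, Complex.normSq_add_mul_I]; ring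
      simp only [h1, norm_smul, mul_pow, h2, mul_inv]
  have hd : DifferentiableAt ℝ φ z :=
    (hφ.smooth.contDiffAt (hΩ.mem_nhds hz)).differentiableAt (by simp)
  have k3 := hk.normSq_pairing_le hz hA (u := delta φ z) (by rwa [← gradLengthSq_eq]) z
  have k4 := hφ.re_vecForm hΩ hz z
  have k5 : ∑ α, delta φ z α * z α
      = (fderiv ℝ φ z z - Complex.I * fderiv ℝ φ z (Complex.I • z)) / 2 := sum_dz_ofReal_mul hd z
  rw [k5] at k3
  set a := fderiv ℝ φ z z
  set a' := fderiv ℝ φ z (Complex.I • z)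
  have k6 : Complex.normSq (((a : ℂ) - Complex.I * a') / 2) = (a ^ 2 + a' ^ 2) / 4 := by
    have : ((a : ℂ) - Complex.I * a') / 2 = ((a / 2 : ℝ) : ℂ) + ((-a' / 2 : ℝ) : ℂ) * Complex.I := by
      push_cast; ring
    rw [this, Complex.normSq_add_mul_I]; ring
  rw [k6] at k3
  set H := fderiv ℝ (fderiv ℝ φ) z z z
  set H' := fderiv ℝ (fderiv ℝ φ) z (Complex.I • z) (Complex.I • z)
  have k7 : (a ^ 2 / A ^ 2 - H / A) + (a' ^ 2 / A ^ 2 - H' / A) ≤ 0 := by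
    have : (a ^ 2 / A ^ 2 - H / A) + (a' ^ 2 / A ^ 2 - H' / A)
        = (a ^ 2 + a' ^ 2 - A * (H + H')) / A ^ 2 := by
      field_simp; ring
    rw [this]
    exact div_nonpos_of_nonpos_of_nonneg (by nlinarith) (by positivity)
  have k8 := mul_nonpos_of_nonneg_of_nonpos (Real.exp_pos (-φ z / A)).le k7
  have k9 : 0 < c * (4 / ‖z‖ ^ 2) := by positivity
  have k10 : c * (6 / ‖z‖ ^ 2) + c * (-2 / ‖z‖ ^ 2) = c * (4 / ‖z‖ ^ 2) := by ring
  linarith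

/-- Comparison on the shells `1/2 ≤ ‖w‖ ≤ ρ` with a multiple of `‖w‖⁻² - ρ⁻²`, which vanishes on the
outer sphere. Nothing is known about `φ` at the unit sphere, so one takes `ρ < 1` and lets `ρ → 1`
with the multiple fixed. -/
theorem exists_hopf_lower_bound (hk : IsKahlerMetricOn g (unitBall n))
    (hφ : IsPotentialOn g (unitBall n) φ) {A : ℝ} (hA : 0 < A)
    (hgrad : ∀ z ∈ unitBall n, gradLengthSq g φ z ≤ A) :
    ∃ c : ℝ, 0 < c ∧ ∀ z : Cn n, 1 / 2 ≤ ‖z‖ → ‖z‖ < 1 →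
      c * ((‖z‖ ^ 2)⁻¹ - 1) ≤ Real.exp (-φ z / A) := by
  set q : Cn n → ℝ := fun z => Real.exp (-φ z / A)
  have hq : ContinuousOn q (unitBall n) :=
    (hφ.smooth.continuousOn.neg.div_const A).rexp
  have hsub : Metric.closedBall (0 : Cn n) (1 / 2) ⊆ unitBall n :=
    Metric.closedBall_subset_ball (by norm_num)
  obtain ⟨m, hm, hmq⟩ : ∃ m > 0, ∀ z : Cn n, ‖z‖ ≤ 1 / 2 → m ≤ q z := by
    obtain ⟨x, -, hx⟩ := (isCompact_closedBall (0 : Cn n) (1 / 2)).exists_isMinOn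
      ⟨0, by simp⟩ (hq.mono hsub)
    exact ⟨q x, Real.exp_pos _, fun z hz => hx (by simpa using hz)⟩
  -- On the inner sphere the barrier is below `(1/2)⁻² = 4`, so this multiple keeps it below `m /
  -- 2`, hence below `e^{-φ/A}`.
  refine ⟨m / 8, by positivity, ?_⟩
  have main : ∀ ρ : ℝ, ρ < 1 → ∀ z : Cn n, 1 / 2 ≤ ‖z‖ → ‖z‖ ≤ ρ →
      m / 8 * ((‖z‖ ^ 2)⁻¹ - (ρ ^ 2)⁻¹) ≤ q z := by
    intro ρ hρ z hz1 hz2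
    set S : Set (Cn n) := {w | 1 / 2 ≤ ‖w‖ ∧ ‖w‖ ≤ ρ}
    set f : Cn n → ℝ := fun w => Real.exp (-φ w / A) - m / 8 * ((‖w‖ ^ 2)⁻¹ - (ρ ^ 2)⁻¹)
    have hS : IsCompact S := by
      refine (isCompact_closedBall (0 : Cn n) ρ).of_isClosed_subset ?_ fun w hw => by
        simpa using hw.2
      exact (isClosed_le continuous_const continuous_norm).inter
        (isClosed_le continuous_norm continuous_const)
    have hSB : S ⊆ unitBall n := fun w hw => by
      simpa [unitBall] using hw.2.trans_lt hρ
    have hf : ContinuousOn f S := by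
      refine (hq.mono hSB).sub (continuousOn_const.mul (ContinuousOn.sub
        (ContinuousOn.inv₀ (by fun_prop) fun w hw => ?_) continuousOn_const))
      have : 0 < ‖w‖ := by linarith [hw.1]
      positivity
    obtain ⟨x, hxS, hx⟩ := hS.exists_isMinOn ⟨z, hz1, hz2⟩ hf
    by_contra! hlt
    have hfx : f x < 0 := (hx (show z ∈ S from ⟨hz1, hz2⟩)).trans_lt (by
      simp only [f]; simp only [q] at hlt; linarith)
    have hx0 : 0 < ‖x‖ := by linarith [hxS.1]
    have hρ0 : 0 < ρ := hx0.trans_le hxS.2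
    have hx1 : 1 / 2 < ‖x‖ := by
      refine lt_of_le_of_ne hxS.1 fun he => ?_
      have h1 := hmq x he.ge
      have h2 : 0 < (ρ ^ 2)⁻¹ := by positivity
      simp only [f, ← he] at hfx
      simp only [q] at h1
      norm_num at hfx
      nlinarith
    have hx2 : ‖x‖ < ρ := by
      refine lt_of_le_of_ne hxS.2 fun he => ?_
      simp only [f, he, sub_self, mul_zero, sub_zero] at hfx
      exact absurd hfx (Real.exp_pos _).not_gt
    have hloc : IsLocalMin f x := by
      refine hx.isLocalMin ?_
      have h1 : {w : Cn n | 1 / 2 < ‖w‖} ∩ {w | ‖w‖ < ρ} ∈ nhds x :=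
        ((isOpen_lt continuous_const continuous_norm).inter
          (isOpen_lt continuous_norm continuous_const)).mem_nhds ⟨hx1, hx2⟩
      exact Filter.mem_of_superset h1 fun w hw => ⟨hw.1.le, hw.2.le⟩
    exact exp_neg_div_nonneg_of_isMin isOpen_unitBall hk hφ (hSB hxS) hA (by positivity)
      (hgrad x (hSB hxS)) (norm_pos_iff.1 hx0) hloc
  intro z hz1 hz2
  have ht : Filter.Tendsto (fun ρ : ℝ => m / 8 * ((‖z‖ ^ 2)⁻¹ - (ρ ^ 2)⁻¹))
      (nhdsWithin 1 (Set.Iio 1))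
      (nhds (m / 8 * ((‖z‖ ^ 2)⁻¹ - 1))) := by
    have : ContinuousAt (fun ρ : ℝ => m / 8 * ((‖z‖ ^ 2)⁻¹ - (ρ ^ 2)⁻¹)) 1 := by
      refine continuousAt_const.mul (continuousAt_const.sub (ContinuousAt.inv₀ (by fun_prop) ?_))
      norm_num
    simpa using this.tendsto.mono_left nhdsWithin_le_nhds
  refine le_of_tendsto ht ?_
  filter_upwards [Ioo_mem_nhdsLT hz2] with ρ hρ using main ρ hρ.2 z hz1 hρ.1.le

/-- `e^{θφ}` grows at most like `(1 - ‖z‖)^{-θA}`. -/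
theorem exists_exp_potential_le (hk : IsKahlerMetricOn g (unitBall n))
    (hφ : IsPotentialOn g (unitBall n) φ) {A θ : ℝ} (hA : 0 < A) (hθ : 0 ≤ θ)
    (hgrad : ∀ z ∈ unitBall n, gradLengthSq g φ z ≤ A) :
    ∃ C : ℝ, ∀ z ∈ unitBall n, Real.exp (θ * φ z) ≤ C * (1 - ‖z‖) ^ (-(θ * A)) := by
  obtain ⟨c, hc, hcz⟩ := exists_hopf_lower_bound hk hφ hA hgrad
  have hsub : Metric.closedBall (0 : Cn n) (1 / 2) ⊆ unitBall n :=
    Metric.closedBall_subset_ball (by norm_num)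
  obtain ⟨x, -, hx⟩ := (isCompact_closedBall (0 : Cn n) (1 / 2)).exists_isMaxOn
      ⟨0, by simp⟩ (hφ.smooth.continuousOn.mono hsub)
  refine ⟨max (Real.exp (θ * φ x)) (c ^ (-(θ * A))), fun z hz => ?_⟩
  have hz1 : ‖z‖ < 1 := by simpa [unitBall] using hz
  have hpos : 0 < 1 - ‖z‖ := by linarith
  rcases le_or_gt (1 / 2) ‖z‖ with h | h
  · have h1 : c * (1 - ‖z‖) ≤ Real.exp (-φ z / A) := by
      refine le_trans ?_ (hcz z h hz1)
      refine mul_le_mul_of_nonneg_left ?_ hc.le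
      have h2 : 0 < ‖z‖ ^ 2 := by positivity
      -- The barrier dominates the distance to the sphere: `1 - r ≤ r⁻² - 1` for `0 < r < 1`.
      rw [le_sub_iff_add_le, ← one_div, le_div_iff₀ h2]
      nlinarith [mul_nonneg hpos.le hpos.le, norm_nonneg z]
    calc Real.exp (θ * φ z) = (Real.exp (-φ z / A)) ^ (-(θ * A)) := by
          rw [← Real.exp_mul]; congr 1; field_simp
      _ ≤ (c * (1 - ‖z‖)) ^ (-(θ * A)) :=
          Real.rpow_le_rpow_of_nonpos (by positivity) h1 (by nlinarith [mul_nonneg hθ hA.le])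
      _ = c ^ (-(θ * A)) * (1 - ‖z‖) ^ (-(θ * A)) := Real.mul_rpow hc.le hpos.le
      _ ≤ _ := by gcongr; exact le_max_right _ _
  · have h1 : φ z ≤ φ x := hx (by simpa using h.le)
    have h2 : 1 ≤ (1 - ‖z‖) ^ (-(θ * A)) :=
      Real.one_le_rpow_of_pos_of_le_one_of_nonpos hpos (by linarith [norm_nonneg z])
        (by nlinarith [mul_nonneg hθ hA.le])
    calc Real.exp (θ * φ z) ≤ Real.exp (θ * φ x) := by gcongr
      _ ≤ max (Real.exp (θ * φ x)) (c ^ (-(θ * A))) * 1 := by rw [mul_one]; exact le_max_left _ _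
      _ ≤ _ := by gcongr

-- In polar coordinates the Jacobian `r ^ d` is at most `1` on `(0, 1)`, and what remains is the
-- one-variable integral of `(1 - r)^{-a}`.
open MeasureTheory in
theorem integrableOn_one_sub_norm_rpow (hn : 1 ≤ n) {a : ℝ} (ha1 : a < 1) :
    IntegrableOn (fun z : Cn n => (1 - ‖z‖) ^ (-a)) (unitBall n) := by
  have : Nonempty (Fin n) := ⟨⟨0, hn⟩⟩
  have : Nontrivial (Cn n) := inferInstance
  have hS : MeasurableSet (Set.Iio (1 : ℝ)) := measurableSet_Iio
  rw [← integrable_indicator_iff isOpen_unitBall.measurableSet]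
  have e : (unitBall n).indicator (fun z : Cn n => (1 - ‖z‖) ^ (-a))
      = fun z => (Set.Iio (1 : ℝ)).indicator (fun r => (1 - r) ^ (-a)) ‖z‖ := by
    ext z
    simp [Set.indicator, unitBall]
  rw [e, integrable_fun_norm_addHaar]
  have h1 : IntervalIntegrable (fun x : ℝ => x ^ (-a)) volume 0 1 :=
    intervalIntegral.intervalIntegrable_rpow' (by linarith)
  have h2 : IntegrableOn (fun r : ℝ => (1 - r) ^ (-a)) (Set.Ioo 0 1) := by
    have := (h1.comp_sub_left 1).symm
    simp only [sub_zero, sub_self] at this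
    exact ((intervalIntegrable_iff_integrableOn_Ioc_of_le zero_le_one).1 this).mono_set
      Set.Ioo_subset_Ioc_self
  set d := Module.finrank ℝ (Cn n) - 1
  have h3 : IntegrableOn (fun r : ℝ => r ^ d • (1 - r) ^ (-a)) (Set.Ioo 0 1) := by
    refine h2.mono' ?_ ?_
    · exact Measurable.aestronglyMeasurable (by fun_prop)
    · refine (ae_restrict_iff' measurableSet_Ioo).2 (Filter.Eventually.of_forall fun r hr => ?_)
      have hp : 0 ≤ (1 - r) ^ (-a) := Real.rpow_nonneg (by linarith [hr.2]) _
      rw [norm_smul, Real.norm_of_nonneg hp, norm_pow, Real.norm_of_nonneg hr.1.le]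
      exact mul_le_of_le_one_left hp (pow_le_one₀ hr.1.le hr.2.le)
  have h4 : (fun y : ℝ => y ^ d • (Set.Iio (1 : ℝ)).indicator (fun r => (1 - r) ^ (-a)) y)
      = (Set.Iio (1 : ℝ)).indicator (fun r => r ^ d • (1 - r) ^ (-a)) := by
    ext y
    by_cases hy : y < 1 <;> simp [Set.indicator, hy]
  rw [h4, IntegrableOn, integrable_indicator_iff hS, IntegrableOn, Measure.restrict_restrict hS]
  refine IntegrableOn.congr_set_ae h3 ?_
  rw [Set.inter_comm, Set.Ioi_inter_Iio]
  exact Filter.EventuallyEq.rfl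

open MeasureTheory in
theorem integrableOn_exp_potential (hn : 1 ≤ n) (hk : IsKahlerMetricOn g (unitBall n))
    (hφ : IsPotentialOn g (unitBall n) φ) {A θ : ℝ} (hA : 0 < A) (hθ : 0 ≤ θ) (hθA : θ * A < 1)
    (hgrad : ∀ z ∈ unitBall n, gradLengthSq g φ z ≤ A) :
    IntegrableOn (fun z => Real.exp (θ * φ z)) (unitBall n) := by
  obtain ⟨C, hC⟩ := exists_exp_potential_le hk hφ hA hθ hgrad
  refine ((integrableOn_one_sub_norm_rpow hn hθA).const_mul C).mono' ?_ ?_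
  · exact ((continuousOn_const.mul hφ.smooth.continuousOn).rexp).aestronglyMeasurable
      isOpen_unitBall.measurableSet
  · refine (ae_restrict_iff' isOpen_unitBall.measurableSet).2
      (Filter.Eventually.of_forall fun z hz => ?_)
    rw [Real.norm_of_nonneg (Real.exp_pos _).le]
    exact hC z hz

end

end KahlerBall

end

/-! ### Hopf-Rinow for length spaces. -/

noncomputable section

namespace KahlerBall

/-- The Hopf-Rinow theorem for complete locally compact length spaces: closed balls are compact. -/
theorem isCompact_closedEBall_of_complete {X : Type*} [PseudoEMetricSpace X] [CompleteSpace X]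
    [WeaklyLocallyCompactSpace X] (o : X)
    (hlen : ∀ (x : X) (R ε : ℝ), 0 ≤ R → 0 < ε → edist x o < ENNReal.ofReal (R + ε) →
      ∃ y, edist y o ≤ ENNReal.ofReal R ∧ edist x y < ENNReal.ofReal ε) (R : ℝ) :
    IsCompact (Metric.closedEBall o (ENNReal.ofReal R)) := by
  have hmono : ∀ R R' : ℝ, R ≤ R' → IsCompact (Metric.closedEBall o (ENNReal.ofReal R')) →
      IsCompact (Metric.closedEBall o (ENNReal.ofReal R)) := fun R R' hR h =>
    h.of_isClosed_subset Metric.isClosed_closedEBall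
      (Metric.closedEBall_subset_closedEBall (ENNReal.ofReal_le_ofReal hR))
  -- The radii of compact balls are shown to be open here and closed in `hlim`; the supremum
  -- argument at the end combines the two. In this step, a compact ball has a thickening inside a
  -- compact set, and the length property puts a slightly larger ball in that thickening.
  have hext : ∀ (s : ℝ) (K : Set X), 0 ≤ s → IsCompact K →
      Metric.closedEBall o (ENNReal.ofReal s) ⊆ K →
      ∃ δ > 0, IsCompact (Metric.closedEBall o (ENNReal.ofReal (s + δ))) := by
    intro s K hs hK hsK
    obtain ⟨K', hK', hKK'⟩ := exists_compact_superset hK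
    obtain ⟨δ, hδ, hsub⟩ := hK.exists_thickening_subset_open isOpen_interior hKK'
    refine ⟨δ / 2, by positivity, hK'.of_isClosed_subset Metric.isClosed_closedEBall ?_⟩
    intro x hx
    refine interior_subset (hsub ((Metric.mem_thickening_iff_exists_edist_lt _ _).2 ?_))
    obtain ⟨y, hy, hxy⟩ := hlen x s δ hs hδ (lt_of_le_of_lt hx
      ((ENNReal.ofReal_lt_ofReal_iff (by linarith)).2 (by linarith)))
    exact ⟨y, hsK hy, hxy⟩
  have hlim : ∀ s : ℝ, 0 < s →
      (∀ R, 0 ≤ R → R < s → IsCompact (Metric.closedEBall o (ENNReal.ofReal R))) →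
      IsCompact (Metric.closedEBall o (ENNReal.ofReal s)) := by
    intro s hs h
    refine TotallyBounded.isCompact_of_isClosed (EMetric.totallyBounded_iff.2 fun ε hε => ?_)
      Metric.isClosed_closedEBall
    obtain ⟨e, he, heε⟩ : ∃ e : ℝ, 0 < e ∧ ENNReal.ofReal (e + e) ≤ ε := by
      obtain ⟨r, hr0, hr⟩ := ENNReal.lt_iff_exists_nnreal_btwn.1 hε
      have hr0' : (0 : ℝ) < r := by exact_mod_cast hr0
      refine ⟨r / 2, by positivity, ?_⟩
      rw [add_halves, ENNReal.ofReal_coe_nnreal]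
      exact hr.le
    -- The ball of this smaller radius is compact, and every point of the ball of radius `s` lies
    -- within `e` of it. A finite `e`-net of the former is then a `2e`-net of the latter.
    have hR : max 0 (s - e / 2) < s := max_lt hs (by linarith)
    obtain ⟨t, htf, ht⟩ := EMetric.totallyBounded_iff.1
      (h _ (le_max_left _ _) hR).totallyBounded (ENNReal.ofReal e) (by simpa using he)
    refine ⟨t, htf, fun x hx => ?_⟩
    have h1 : s < max 0 (s - e / 2) + e := by linarith [le_max_right 0 (s - e / 2)]
    obtain ⟨y, hy, hxy⟩ := hlen x (max 0 (s - e / 2)) e (le_max_left _ _) he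
      (lt_of_le_of_lt hx ((ENNReal.ofReal_lt_ofReal_iff (by linarith)).2 h1))
    obtain ⟨p, hp, hyp⟩ := Set.mem_iUnion₂.1 (ht hy)
    refine Set.mem_iUnion₂.2 ⟨p, hp, ?_⟩
    calc edist x p ≤ edist x y + edist y p := edist_triangle _ _ _
      _ < ENNReal.ofReal e + ENNReal.ofReal e := ENNReal.add_lt_add hxy hyp
      _ ≤ ε := by rwa [← ENNReal.ofReal_add he.le he.le]
  -- In a pseudometric space the ball of radius zero may contain more than its centre, so local
  -- compactness is needed already here.
  have hzero : IsCompact (Metric.closedEBall o (ENNReal.ofReal 0)) := by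
    obtain ⟨K, hK, hoK⟩ := exists_compact_superset (isCompact_singleton (x := o))
    obtain ⟨δ, hδ, hsub⟩ :=
      (isCompact_singleton (x := o)).exists_thickening_subset_open isOpen_interior hoK
    refine hK.of_isClosed_subset Metric.isClosed_closedEBall fun x hx => interior_subset (hsub ?_)
    refine (Metric.mem_thickening_iff_exists_edist_lt _ _).2 ⟨o, rfl, lt_of_le_of_lt hx ?_⟩
    simpa using hδ
  by_contra hcon
  set S : Set ℝ := {r | 0 ≤ r ∧ IsCompact (Metric.closedEBall o (ENNReal.ofReal r))}
  have hS0 : (0 : ℝ) ∈ S := ⟨le_rfl, hzero⟩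
  have hSR : ∀ r ∈ S, r ≤ R := fun r hr => by
    by_contra! hlt
    exact hcon (hmono R r hlt.le hr.2)
  have hbdd : BddAbove S := ⟨R, hSR⟩
  have hs0 : 0 ≤ sSup S := le_csSup hbdd hS0
  have hs : IsCompact (Metric.closedEBall o (ENNReal.ofReal (sSup S))) := by
    rcases hs0.eq_or_lt with h | h
    · rw [← h]; exact hzero
    · refine hlim _ h fun r _ hrs => ?_
      obtain ⟨r', hr', hlt⟩ := exists_lt_of_lt_csSup ⟨0, hS0⟩ hrs
      exact hmono r r' hlt.le hr'.2
  obtain ⟨δ, hδ, hδc⟩ := hext _ _ hs0 hs le_rfl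
  have := le_csSup hbdd (show sSup S + δ ∈ S from ⟨by linarith, hδc⟩)
  linarith

end KahlerBall

end

/-! ### Norm bounds, lengths of curves and the triangle inequality. -/

noncomputable section

namespace KahlerBall

open MeasureTheory Set

variable {n : ℕ} {g : Coeffs n} {Ω : Set (Cn n)} {z x y w : Cn n}

theorem vecForm_smul (c : ℂ) (v : Cn n) :
    vecForm g z (c • v) = (Complex.normSq c : ℂ) * vecForm g z v := by
  simp only [vecForm, PiLp.smul_apply, smul_eq_mul, map_mul, Finset.mul_sum]
  refine Finset.sum_congr rfl fun α _ => Finset.sum_congr rfl fun β _ => ?_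
  rw [← Complex.mul_conj c]; ring

theorem vecLength_smul (t : ℝ) (v : Cn n) : vecLength g z (t • v) = |t| * vecLength g z v := by
  have : t • v = (t : ℂ) • v := (Complex.coe_smul t v).symm
  rw [vecLength_eq, vecLength_eq, this, vecForm_smul, Complex.re_ofReal_mul,
    Complex.normSq_ofReal, Real.sqrt_mul (mul_self_nonneg t), Real.sqrt_mul_self_eq_abs]

theorem vecLength_nonneg (v : Cn n) : 0 ≤ vecLength g z v := Real.sqrt_nonneg _

theorem IsKahlerMetricOn.vecForm_pos (hk : IsKahlerMetricOn g Ω) (hz : z ∈ Ω) {v : Cn n}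
    (hv : v ≠ 0) : 0 < (vecForm g z v).re := by
  have hv' : (fun α => (starRingEnd ℂ) (v α)) ≠ 0 := fun h => hv (by
    ext α
    simpa using congrFun h α)
  have := (hk.posDef z hz).re_dotProduct_pos hv'
  convert! this using 1
  simp only [vecForm, dotProduct, Matrix.mulVec, Finset.mul_sum, Pi.star_apply, RCLike.star_def,
    Complex.conj_conj, RCLike.re_eq_complex_re]
  congr 1
  exact Finset.sum_congr rfl fun α _ => Finset.sum_congr rfl fun β _ => by ring

theorem IsKahlerMetricOn.continuousOn_vecLength (hk : IsKahlerMetricOn g Ω) :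
    ContinuousOn (fun p : Cn n × Cn n => vecLength g p.1 p.2) (Ω ×ˢ univ) := by
  unfold vecLength
  refine (Complex.continuous_re.comp_continuousOn ?_).sqrt
  refine continuousOn_finsetSum _ fun α _ => continuousOn_finsetSum _ fun β _ => ?_
  refine ((((hk.smooth α β).continuousOn.comp continuousOn_fst fun p hp => hp.1)).mul ?_).mul ?_
  · fun_prop
  · exact (Complex.continuous_conj.comp
      (by fun_prop : Continuous fun p : Cn n × Cn n => p.2 β)).continuousOn

/-- Homogeneity reduces the comparison to unit vectors, where continuity and positivity on the
compact set `K × S` give the two constants. -/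
theorem IsKahlerMetricOn.exists_vecLength_bounds (hk : IsKahlerMetricOn g Ω) {K : Set (Cn n)}
    (hK : IsCompact K) (hKΩ : K ⊆ Ω) : ∃ m M : ℝ, 0 < m ∧ 0 < M ∧ ∀ z ∈ K, ∀ v : Cn n,
      m * ‖v‖ ≤ vecLength g z v ∧ vecLength g z v ≤ M * ‖v‖ := by
  have hcomp : IsCompact (K ×ˢ Metric.sphere (0 : Cn n) 1) := hK.prod (isCompact_sphere _ _)
  have hcont : ContinuousOn (fun p : Cn n × Cn n => vecLength g p.1 p.2)
      (K ×ˢ Metric.sphere (0 : Cn n) 1) :=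
    hk.continuousOn_vecLength.mono (prod_mono hKΩ (subset_univ _))
  obtain ⟨m, hm, hmb⟩ : ∃ m > 0, ∀ p ∈ K ×ˢ Metric.sphere (0 : Cn n) 1,
      m ≤ vecLength g p.1 p.2 := by
    refine hcomp.exists_forall_le' hcont fun p hp => ?_
    refine Real.sqrt_pos.2 (hk.vecForm_pos (hKΩ hp.1) fun h0 => ?_)
    have := hp.2
    simp [h0] at this
  obtain ⟨M, hM⟩ := hcomp.exists_bound_of_continuousOn hcont
  refine ⟨m, max M 1, hm, by positivity, fun z hz v => ?_⟩
  rcases eq_or_ne v 0 with rfl | hv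
  · simp [vecLength]
  have hv0 : 0 < ‖v‖ := norm_pos_iff.2 hv
  have hmem : (z, ‖v‖⁻¹ • v) ∈ K ×ˢ Metric.sphere (0 : Cn n) 1 := by
    refine ⟨hz, ?_⟩
    simp [norm_smul, hv0.ne']
  have e : vecLength g z v = vecLength g z (‖v‖⁻¹ • v) * ‖v‖ := by
    rw [vecLength_smul, abs_of_pos (by positivity)]; field_simp
  rw [e]
  constructor
  · gcongr
    exact hmb (z, ‖v‖⁻¹ • v) hmem
  · gcongr
    refine le_trans ?_ (le_max_left _ _)
    exact (le_abs_self _).trans (hM (z, ‖v‖⁻¹ • v) hmem)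

/-- The speed of a curve parametrized by `[0,1]`. -/
def speed (g : Coeffs n) (γ : ℝ → Cn n) (t : ℝ) : ℝ :=
  vecLength g (γ t) (derivWithin γ (Icc 0 1) t)

section curves

variable {γ η : ℝ → Cn n}

theorem IsCurveIn.continuousOn_speed (hk : IsKahlerMetricOn g Ω) (hγ : IsCurveIn Ω x y γ) :
    ContinuousOn (speed g γ) (Icc 0 1) := by
  have h0 : ContinuousOn (derivWithin γ (Icc 0 1)) (Icc 0 1) :=
    hγ.contDiffOn.continuousOn_derivWithin (uniqueDiffOn_Icc zero_lt_one) le_rfl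
  have h1 : ContinuousOn (fun t => (γ t, derivWithin γ (Icc 0 1) t)) (Icc 0 1) :=
    hγ.contDiffOn.continuousOn.prodMk h0
  have h2 : MapsTo (fun t => (γ t, derivWithin γ (Icc 0 1) t)) (Icc 0 1) (Ω ×ˢ univ) :=
    fun t ht => ⟨hγ.mapsTo ht, mem_univ _⟩
  have h3 := ContinuousOn.comp (hk.continuousOn_vecLength) h1 h2
  exact h3

theorem IsCurveIn.intervalIntegrable_speed (hk : IsKahlerMetricOn g Ω) (hγ : IsCurveIn Ω x y γ)
    {a b : ℝ} (ha : a ∈ Icc (0 : ℝ) 1) (hb : b ∈ Icc (0 : ℝ) 1) :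
    IntervalIntegrable (speed g γ) volume a b :=
  ((hγ.continuousOn_speed hk).mono (ordConnected_Icc.uIcc_subset ha hb)).intervalIntegrable

theorem IsCurveIn.curveLength_eq (hk : IsKahlerMetricOn g Ω) (hγ : IsCurveIn Ω x y γ) :
    curveLength g γ = ENNReal.ofReal (∫ t in (0 : ℝ)..1, speed g γ t) := by
  rw [intervalIntegral.integral_of_le zero_le_one, ← integral_Icc_eq_integral_Ioc,
    ofReal_integral_eq_lintegral_ofReal ((hγ.continuousOn_speed hk).integrableOn_Icc)
      (Filter.Eventually.of_forall fun t => vecLength_nonneg _)]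
  rfl

theorem metricDist_le (hk : IsKahlerMetricOn g Ω) (hγ : IsCurveIn Ω x y γ) :
    metricDist g Ω x y ≤ ENNReal.ofReal (∫ t in (0 : ℝ)..1, speed g γ t) := by
  rw [← hγ.curveLength_eq hk]
  exact iInf₂_le γ hγ

theorem exists_curve_of_metricDist_lt (hk : IsKahlerMetricOn g Ω) {L : ENNReal}
    (h : metricDist g Ω x y < L) : ∃ γ, IsCurveIn Ω x y γ ∧
      ENNReal.ofReal (∫ t in (0 : ℝ)..1, speed g γ t) < L := by
  simp only [metricDist, iInf_lt_iff] at h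
  obtain ⟨γ, hγ, hL⟩ := h
  exact ⟨γ, hγ, by rwa [← hγ.curveLength_eq hk]⟩

/-- The speed of a reparametrized curve. -/
theorem IsCurveIn.integral_speed_comp (hγ : IsCurveIn Ω x y γ) {a b : ℝ} (ha : 0 ≤ a)
    (hab : a ≤ b) (hb : b ≤ 1) {σ σ' : ℝ → ℝ} (hσ : ∀ t, HasDerivAt σ (σ' t) t)
    (hmaps : MapsTo σ (Icc a b) (Icc 0 1)) (hη : EqOn η (γ ∘ σ) (Icc a b)) :
    ∫ t in a..b, speed g η t = ∫ t in a..b, speed g γ (σ t) * |σ' t| := by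
  rw [intervalIntegral.integral_of_le hab, intervalIntegral.integral_of_le hab,
    integral_Ioc_eq_integral_Ioo, integral_Ioc_eq_integral_Ioo]
  refine setIntegral_congr_fun measurableSet_Ioo fun t ht => ?_
  have htI : t ∈ Icc a b := Ioo_subset_Icc_self ht
  have hmem : Icc a b ∈ nhds t := Icc_mem_nhds ht.1 ht.2
  have hmem' : Icc (0 : ℝ) 1 ∈ nhds t :=
    Filter.mem_of_superset hmem (Icc_subset_Icc ha hb)
  have hd : HasDerivWithinAt γ (derivWithin γ (Icc 0 1) (σ t)) (Icc 0 1) (σ t) :=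
    ((hγ.contDiffOn.differentiableOn (by simp)) (σ t) (hmaps htI)).hasDerivWithinAt
  have hd2 : HasDerivWithinAt (γ ∘ σ) (σ' t • derivWithin γ (Icc 0 1) (σ t)) (Icc a b) t :=
    hd.scomp t (hσ t).hasDerivWithinAt hmaps
  have hd3 : HasDerivAt η (σ' t • derivWithin γ (Icc 0 1) (σ t)) t :=
    (hd2.hasDerivAt hmem).congr_of_eventuallyEq (Filter.eventually_of_mem hmem hη)
  simp only [speed]
  rw [derivWithin_of_mem_nhds hmem', hd3.deriv, vecLength_smul, hη htI, Function.comp_apply,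
    mul_comm]

theorem IsCurveIn.integral_speed_comp_of_nonneg (hγ : IsCurveIn Ω x y γ)
    {a b : ℝ} (ha : 0 ≤ a) (hab : a ≤ b) (hb : b ≤ 1) {σ σ' : ℝ → ℝ}
    (hσ : ∀ t, HasDerivAt σ (σ' t) t) (hσ' : ∀ t, 0 ≤ σ' t)
    (hmaps : MapsTo σ (Icc a b) (Icc 0 1)) (hη : EqOn η (γ ∘ σ) (Icc a b)) :
    ∫ t in a..b, speed g η t = ∫ t in (σ a)..(σ b), speed g γ t := by
  rw [hγ.integral_speed_comp ha hab hb hσ hmaps hη]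
  simp only [abs_of_nonneg (hσ' _)]
  exact intervalIntegral.integral_comp_mul_deriv_of_deriv_nonneg (g := speed g γ)
    (fun t _ => (hσ t).continuousAt.continuousWithinAt) (fun t _ => hσ t) fun t _ => hσ' t

theorem IsCurveIn.metricDist_apply_le (hk : IsKahlerMetricOn g Ω) (hγ : IsCurveIn Ω x y γ)
    {a b : ℝ} (ha : 0 ≤ a) (hab : a ≤ b) (hb : b ≤ 1) :
    metricDist g Ω (γ a) (γ b) ≤ ENNReal.ofReal (∫ t in a..b, speed g γ t) := by
  set σ : ℝ → ℝ := fun t => a + (b - a) * t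
  have hmaps : MapsTo σ (Icc 0 1) (Icc 0 1) := fun t ht => by
    have h1 := mul_nonneg (sub_nonneg.2 hab) ht.1
    have h2 := mul_nonneg (sub_nonneg.2 hab) (sub_nonneg.2 ht.2)
    constructor <;> simp only [σ] <;> linarith
  have hσ : ∀ t, HasDerivAt σ (b - a) t := fun t => by
    convert! ((hasDerivAt_id t).const_mul (b - a)).const_add a using 1
    simp
  have hσc : ContDiff ℝ 1 σ := by fun_prop
  have hη : IsCurveIn Ω (γ a) (γ b) (γ ∘ σ) :=
    { contDiffOn := hγ.contDiffOn.comp hσc.contDiffOn hmaps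
      mapsTo := hγ.mapsTo.comp hmaps
      source := by simp [σ]
      target := by simp [σ] }
  refine (metricDist_le hk hη).trans_eq ?_
  rw [hγ.integral_speed_comp_of_nonneg le_rfl zero_le_one le_rfl hσ (fun _ => sub_nonneg.2 hab)
    hmaps fun t _ => rfl]
  simp [σ]

theorem metricDist_self (hk : IsKahlerMetricOn g Ω) (hx : x ∈ Ω) : metricDist g Ω x x = 0 := by
  have hc : IsCurveIn Ω x x (fun _ => x) := ⟨contDiffOn_const, fun _ _ => hx, rfl, rfl⟩
  have := metricDist_le hk hc
  have h0 : ∀ t, speed g (fun _ => x) t = 0 := fun t => by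
    simp [speed, vecLength]
  simpa [h0] using this

theorem metricDist_comm_le (hk : IsKahlerMetricOn g Ω) :
    metricDist g Ω y x ≤ metricDist g Ω x y := by
  refine le_iInf₂ fun γ hγ => ?_
  rw [hγ.curveLength_eq hk]
  set σ : ℝ → ℝ := fun t => 1 - t
  have hmaps : MapsTo σ (Icc 0 1) (Icc 0 1) := fun t ht => by
    constructor <;> simp only [σ] <;> linarith [ht.1, ht.2]
  have hσ : ∀ t, HasDerivAt σ (-1) t := fun t => (hasDerivAt_id t).const_sub 1
  have hσc : ContDiff ℝ 1 σ := by fun_prop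
  have hη : IsCurveIn Ω y x (γ ∘ σ) :=
    { contDiffOn := hγ.contDiffOn.comp hσc.contDiffOn hmaps
      mapsTo := hγ.mapsTo.comp hmaps
      source := by simp [σ, hγ.target]
      target := by simp [σ, hγ.source] }
  refine (metricDist_le hk hη).trans_eq ?_
  rw [hγ.integral_speed_comp le_rfl zero_le_one le_rfl hσ hmaps fun t _ => rfl]
  simp [σ]

theorem metricDist_comm (hk : IsKahlerMetricOn g Ω) :
    metricDist g Ω x y = metricDist g Ω y x :=
  le_antisymm (metricDist_comm_le hk) (metricDist_comm_le hk)

theorem metricDist_triangle (hk : IsKahlerMetricOn g Ω) :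
    metricDist g Ω x w ≤ metricDist g Ω x y + metricDist g Ω y w := by
  refine ENNReal.le_iInf₂_add_iInf₂ fun γ₁ h₁ γ₂ h₂ => ?_
  rw [h₁.curveLength_eq hk, h₂.curveLength_eq hk]
  -- Concatenation must stay `C¹`. Each curve is reparametrized by a step that is constant outside
  -- its half of the interval, so `γ₁ ∘ σ₁ + γ₂ ∘ σ₂ - y` is `C¹` everywhere and reduces on each
  -- half to one of the curves. Length is unchanged because the steps are monotone.
  set S := Real.smoothTransition
  have hSc : ContDiff ℝ 1 S := Real.smoothTransition.contDiff
  have hS : ∀ t, S t ∈ Icc (0 : ℝ) 1 := fun t =>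
    ⟨Real.smoothTransition.nonneg t, Real.smoothTransition.le_one t⟩
  have hSd : ∀ t, HasDerivAt S (deriv S t) t := fun t =>
    (hSc.differentiable (by simp) t).hasDerivAt
  have hSm : ∀ t, 0 ≤ deriv S t := fun t => Real.smoothTransition.monotone.deriv_nonneg
  set σ₁ : ℝ → ℝ := fun t => S (2 * t)
  set σ₂ : ℝ → ℝ := fun t => S (2 * t - 1)
  have hd₁ : ∀ t, HasDerivAt σ₁ (deriv S (2 * t) * 2) t := fun t =>
    (hSd (2 * t)).comp t (by simpa using (hasDerivAt_id t).const_mul 2)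
  have hd₂ : ∀ t, HasDerivAt σ₂ (deriv S (2 * t - 1) * 2) t := fun t =>
    (hSd (2 * t - 1)).comp (h := fun t => 2 * t - 1) t
      (by simpa using ((hasDerivAt_id t).const_mul 2).sub_const 1)
  have hc₁ : ContDiff ℝ 1 (γ₁ ∘ σ₁) :=
    h₁.contDiffOn.comp_contDiff (hSc.comp (by fun_prop)) fun t => hS _
  have hc₂ : ContDiff ℝ 1 (γ₂ ∘ σ₂) :=
    h₂.contDiffOn.comp_contDiff (hSc.comp (by fun_prop)) fun t => hS _
  set η : ℝ → Cn n := fun t => (γ₁ ∘ σ₁) t + (γ₂ ∘ σ₂) t - y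
  have e₁ : EqOn η (γ₁ ∘ σ₁) (Iic (1 / 2)) := fun t ht => by
    have : σ₂ t = 0 := Real.smoothTransition.zero_of_nonpos (by linarith [mem_Iic.1 ht])
    simp [η, this, h₂.source]
  have e₂ : EqOn η (γ₂ ∘ σ₂) (Ici (1 / 2)) := fun t ht => by
    have : σ₁ t = 1 := Real.smoothTransition.one_of_one_le (by linarith [mem_Ici.1 ht])
    simp [η, this, h₁.target]
  have hη : IsCurveIn Ω x w η :=
    { contDiffOn := ((hc₁.add hc₂).sub contDiff_const).contDiffOn
      mapsTo := fun t _ => by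
        rcases le_total t (1 / 2) with h | h
        · rw [e₁ h]; exact h₁.mapsTo (hS _)
        · rw [e₂ h]; exact h₂.mapsTo (hS _)
      source := by
        rw [e₁ (by simp)]
        simp [σ₁, S, h₁.source]
      target := by
        rw [e₂ (by norm_num)]
        have : σ₂ 1 = 1 := Real.smoothTransition.one_of_one_le (by norm_num)
        rw [Function.comp_apply, this, h₂.target] }
  refine (metricDist_le hk hη).trans_eq ?_
  have hhalf : (1 / 2 : ℝ) ∈ Icc (0 : ℝ) 1 := by constructor <;> norm_num
  have hnn : ∀ γ : ℝ → Cn n, 0 ≤ ∫ t in (0 : ℝ)..1, speed g γ t := fun γ =>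
    intervalIntegral.integral_nonneg zero_le_one fun t _ => vecLength_nonneg _
  rw [← ENNReal.ofReal_add (hnn _) (hnn _), ← intervalIntegral.integral_add_adjacent_intervals
    (hη.intervalIntegrable_speed hk (by simp) hhalf)
    (hη.intervalIntegrable_speed hk hhalf (by simp)),
    h₁.integral_speed_comp_of_nonneg le_rfl hhalf.1 hhalf.2 hd₁
      (fun t => mul_nonneg (hSm _) zero_le_two) (fun t _ => hS _)
      (e₁.mono Icc_subset_Iic_self),
    h₂.integral_speed_comp_of_nonneg hhalf.1 hhalf.2 le_rfl hd₂
      (fun t => mul_nonneg (hSm _) zero_le_two) (fun t _ => hS _)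
      (e₂.mono Icc_subset_Ici_self)]
  have v₁ : σ₁ 0 = 0 := by simp [σ₁, S]
  have v₂ : σ₁ (1 / 2) = 1 := by simp [σ₁, S]
  have v₃ : σ₂ (1 / 2) = 0 := by simp [σ₂, S]
  have v₄ : σ₂ 1 = 1 := Real.smoothTransition.one_of_one_le (by norm_num)
  rw [v₁, v₂, v₃, v₄]

end curves

end KahlerBall

end

/-! ### Comparison with the Euclidean distance and compactness of metric balls. -/

noncomputable section

namespace KahlerBall

open MeasureTheory Set

variable {n : ℕ} {g : Coeffs n} {Ω : Set (Cn n)} {z x y w : Cn n}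

/-- The distance is at most the length of the segment. -/
theorem metricDist_le_of_segment (hmem : ∀ t ∈ Icc (0 : ℝ) 1, x + t • (y - x) ∈ Ω) {b : ℝ}
    (hb : ∀ t ∈ Icc (0 : ℝ) 1, vecLength g (x + t • (y - x)) (y - x) ≤ b) :
    metricDist g Ω x y ≤ ENNReal.ofReal b := by
  set γ : ℝ → Cn n := fun t => x + t • (y - x)
  have hγ : IsCurveIn Ω x y γ :=
    { contDiffOn := by fun_prop
      mapsTo := hmem
      source := by simp [γ]
      target := by simp [γ] }
  have hd : ∀ t ∈ Icc (0 : ℝ) 1, derivWithin γ (Icc 0 1) t = y - x := fun t ht => by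
    have : HasDerivAt γ (y - x) t := by
      convert! ((hasDerivAt_id t).smul_const (y - x)).const_add x using 1
      simp
    exact this.hasDerivWithinAt.derivWithin (uniqueDiffOn_Icc zero_lt_one t ht)
  calc metricDist g Ω x y ≤ curveLength g γ := iInf₂_le γ hγ
    _ ≤ ∫⁻ _ in Icc (0 : ℝ) 1, ENNReal.ofReal b := by
        refine setLIntegral_mono' measurableSet_Icc fun t ht => ?_
        rw [hd t ht]
        exact ENNReal.ofReal_le_ofReal (hb t ht)
    _ = ENNReal.ofReal b := by simp

/-- A curve may leave the ball on which the norms are compared, so its length is counted only up to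
the first time it has moved by `min r ‖y - x‖`. This makes the metric topology at least as fine as
the Euclidean one. -/
theorem le_metricDist {r m : ℝ} (hm : 0 < m)
    (hb : ∀ z ∈ Metric.closedBall x r, ∀ v, m * ‖v‖ ≤ vecLength g z v) :
    ENNReal.ofReal (m * min r ‖y - x‖) ≤ metricDist g Ω x y := by
  refine le_iInf₂ fun γ hγ => ?_
  set s := min r ‖y - x‖
  set T : Set ℝ := {t ∈ Icc (0 : ℝ) 1 | s ≤ ‖γ t - x‖}
  have hcont : ContinuousOn (fun t => ‖γ t - x‖) (Icc 0 1) :=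
    (hγ.contDiffOn.continuousOn.sub continuousOn_const).norm
  have hT : IsCompact T := isCompact_Icc.of_isClosed_subset
    (hcont.preimage_isClosed_of_isClosed isClosed_Icc isClosed_Ici) fun t ht => ht.1
  obtain ⟨t₀, ht₀, hleast⟩ := hT.exists_isLeast
    ⟨1, ⟨by simp, by rw [hγ.target]; exact min_le_right _ _⟩⟩
  have hsub : Icc 0 t₀ ⊆ Icc (0 : ℝ) 1 := Icc_subset_Icc_right ht₀.1.2
  have h1 := enorm_sub_le_lintegral_deriv_of_contDiffOn_Icc (hγ.contDiffOn.mono hsub) ht₀.1.1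
  rw [hγ.source] at h1
  calc ENNReal.ofReal (m * s) = ENNReal.ofReal m * ENNReal.ofReal s :=
        ENNReal.ofReal_mul hm.le
    _ ≤ ENNReal.ofReal m * ‖γ t₀ - x‖ₑ := by
        gcongr
        rw [← ofReal_norm]
        exact ENNReal.ofReal_le_ofReal ht₀.2
    _ ≤ ENNReal.ofReal m * ∫⁻ t in Icc 0 t₀, ‖deriv γ t‖ₑ := by gcongr
    _ = ∫⁻ t in Ioo 0 t₀, ENNReal.ofReal m * ‖deriv γ t‖ₑ := by
        rw [lintegral_const_mul' _ _ ENNReal.ofReal_ne_top, restrict_Ioo_eq_restrict_Icc]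
    _ ≤ ∫⁻ t in Ioo 0 t₀, ENNReal.ofReal (vecLength g (γ t) (derivWithin γ (Icc 0 1) t)) := by
        refine setLIntegral_mono' measurableSet_Ioo fun t ht => ?_
        have htI : t ∈ Icc (0 : ℝ) 1 := hsub (Ioo_subset_Icc_self ht)
        rw [derivWithin_of_mem_nhds (Icc_mem_nhds ht.1 (ht.2.trans_le ht₀.1.2)), ← ofReal_norm,
          ← ENNReal.ofReal_mul hm.le]
        refine ENNReal.ofReal_le_ofReal (hb _ ?_ _)
        rw [mem_closedBall_iff_norm]
        by_contra! hlt
        exact absurd (hleast ⟨htI, (min_le_left _ _).trans hlt.le⟩) (not_le.2 ht.2)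
    _ ≤ curveLength g γ := lintegral_mono_set (Ioo_subset_Icc_self.trans hsub)

theorem mem_closedBall_segment {p : Cn n} {r : ℝ} (hx : x ∈ Metric.closedBall p r)
    (hy : y ∈ Metric.closedBall p r) {t : ℝ} (ht : t ∈ Icc (0 : ℝ) 1) :
    x + t • (y - x) ∈ Metric.closedBall p r :=
  (convex_closedBall p r).add_smul_sub_mem hx hy ht

theorem metricDist_le_mul_norm {p : Cn n} {r M : ℝ} (hball : Metric.closedBall p r ⊆ Ω)
    (hb : ∀ z ∈ Metric.closedBall p r, ∀ v, vecLength g z v ≤ M * ‖v‖)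
    (hx : x ∈ Metric.closedBall p r) (hy : y ∈ Metric.closedBall p r) :
    metricDist g Ω x y ≤ ENNReal.ofReal (M * ‖y - x‖) :=
  metricDist_le_of_segment (fun _ ht => hball (mem_closedBall_segment hx hy ht))
    fun _ ht => hb _ (mem_closedBall_segment hx hy ht) _

/-- The points of `Ω`, to be metrized by the distance of a Kähler metric. -/
structure DomainPoint (Ω : Set (Cn n)) where
  /-- The underlying point of `ℂⁿ`. -/
  val : Cn n
  mem : val ∈ Ω

/-- The pseudo-metric structure on `Ω` given by `metricDist`. -/
@[reducible] def domainPseudoEMetric (hk : IsKahlerMetricOn g Ω) :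
    PseudoEMetricSpace (DomainPoint Ω) where
  edist p q := metricDist g Ω p.val q.val
  edist_self p := metricDist_self hk p.mem
  edist_comm _ _ := metricDist_comm hk
  edist_triangle _ _ _ := metricDist_triangle hk

/-- The length property required by Hopf-Rinow. Follow a nearly shortest curve from `z` to `x` until
it has used up length `S`, or all of its length if that is shorter; less than `ε` then remains. -/
theorem exists_intermediate_point (hk : IsKahlerMetricOn g Ω) {S ε : ℝ} (hS : 0 ≤ S)
    (hε : 0 < ε) (hlt : metricDist g Ω x z < ENNReal.ofReal (S + ε)) :
    ∃ y ∈ Ω, metricDist g Ω y z ≤ ENNReal.ofReal S ∧ metricDist g Ω x y < ENNReal.ofReal ε := by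
  obtain ⟨γ, hγ, hL⟩ := exists_curve_of_metricDist_lt hk ((metricDist_comm hk).trans_lt hlt)
  set L := ∫ t in (0 : ℝ)..1, speed g γ t
  have hL' : L < S + ε := (ENNReal.ofReal_lt_ofReal_iff (by linarith)).1 hL
  have hL0 : 0 ≤ L := intervalIntegral.integral_nonneg zero_le_one fun t _ => vecLength_nonneg _
  have hint : ∀ a ∈ Icc (0 : ℝ) 1, ∀ b ∈ Icc (0 : ℝ) 1,
      IntervalIntegrable (speed g γ) volume a b := fun a ha b hb =>
    hγ.intervalIntegrable_speed hk ha hb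
  have h0 : (0 : ℝ) ∈ Icc (0 : ℝ) 1 := by simp
  have h1 : (1 : ℝ) ∈ Icc (0 : ℝ) 1 := by simp
  have hprim : ContinuousOn (fun t => ∫ s in (0 : ℝ)..t, speed g γ s) (Icc 0 1) := by
    have := intervalIntegral.continuousOn_primitive_interval' (hint 0 h0 1 h1) left_mem_uIcc
    rwa [uIcc_of_le zero_le_one] at this
  obtain ⟨t, ht, hte⟩ := intermediate_value_Icc zero_le_one hprim
    (show min S L ∈ _ from ⟨by simpa using ⟨hS, hL0⟩, min_le_right _ _⟩)
  have hsplit := intervalIntegral.integral_add_adjacent_intervals (hint 0 h0 t ht) (hint t ht 1 h1)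
  simp only at hte
  refine ⟨γ t, hγ.mapsTo ht, ?_, ?_⟩
  · rw [metricDist_comm hk]
    have := hγ.metricDist_apply_le hk le_rfl ht.1 ht.2
    rw [hγ.source, hte] at this
    exact this.trans (ENNReal.ofReal_le_ofReal (min_le_left _ _))
  · rw [metricDist_comm hk]
    have := hγ.metricDist_apply_le hk ht.1 ht.2 le_rfl
    rw [hγ.target] at this
    refine this.trans_lt ((ENNReal.ofReal_lt_ofReal_iff hε).2 ?_)
    have : L - min S L < ε := by
      rcases min_cases S L with h | h <;> linarith
    linarith

/-- Closed balls of a complete Kähler metric are compact. -/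
theorem IsKahlerMetricOn.isCompact_metricBall (hk : IsKahlerMetricOn g Ω) (hΩ : IsOpen Ω)
    (hc : IsCompleteOn g Ω) {o : Cn n} (ho : o ∈ Ω) (R : ℝ) :
    IsCompact {z ∈ Ω | metricDist g Ω z o ≤ ENNReal.ofReal R} := by
  let _ := domainPseudoEMetric hk
  have hedist : ∀ p q : DomainPoint Ω, edist p q = metricDist g Ω p.val q.val := fun _ _ => rfl
  have hloc : ∀ p : DomainPoint Ω, ∃ r m M : ℝ, 0 < r ∧ 0 < m ∧ 0 < M ∧
      Metric.closedBall p.val r ⊆ Ω ∧ ∀ z ∈ Metric.closedBall p.val r, ∀ v : Cn n,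
        m * ‖v‖ ≤ vecLength g z v ∧ vecLength g z v ≤ M * ‖v‖ := fun p => by
    obtain ⟨r, hr, hsub⟩ := Metric.nhds_basis_closedBall.mem_iff.1 (hΩ.mem_nhds p.mem)
    obtain ⟨m, M, hm, hM, hb⟩ := hk.exists_vecLength_bounds (isCompact_closedBall _ _) hsub
    exact ⟨r, m, M, hr, hm, hM, hsub, hb⟩
  -- Continuity from the metric to the Euclidean topology serves twice: it gives neighbourhoods for
  -- local compactness, and it carries the compact metric ball to a compact subset of `ℂⁿ`.
  have hval : Continuous (DomainPoint.val : DomainPoint Ω → Cn n) := by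
    refine continuous_iff_continuousAt.2 fun p => ?_
    obtain ⟨r, m, M, hr, hm, hM, hsub, hb⟩ := hloc p
    refine Metric.nhds_basis_ball.tendsto_right_iff.2 fun ε hε => ?_
    have hpos : 0 < m * min r ε := mul_pos hm (lt_min hr hε)
    filter_upwards [Metric.eball_mem_nhds p (ENNReal.ofReal_pos.2 hpos)] with q hq
    by_contra hcon
    have h1 : ε ≤ ‖q.val - p.val‖ := by
      rw [mem_ball_iff_norm] at hcon
      exact not_lt.1 hcon
    have h2 : edist p q < ENNReal.ofReal (m * min r ε) := by rwa [edist_comm]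
    have h3 := le_metricDist (Ω := Ω) (y := q.val) hm fun z hz v => (hb z hz v).1
    rw [hedist] at h2
    refine absurd (h3.trans_lt h2) (not_lt.2 (ENNReal.ofReal_le_ofReal ?_))
    gcongr
  -- Local compactness: a small Euclidean closed ball maps to the metric space by a Lipschitz map,
  -- so its image is compact.
  have hmk : ∀ (p : DomainPoint Ω) (r M : ℝ), 0 < r → 0 < M → Metric.closedBall p.val r ⊆ Ω →
      (∀ z ∈ Metric.closedBall p.val r, ∀ v : Cn n, vecLength g z v ≤ M * ‖v‖) →
      IsCompact ((DomainPoint.val : DomainPoint Ω → Cn n) ⁻¹' Metric.closedBall p.val r) := by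
    intro p r M hr hM hsub hb
    let f : Metric.closedBall p.val r → DomainPoint Ω := fun z => ⟨z.1, hsub z.2⟩
    have hf : LipschitzWith M.toNNReal f := fun a b => by
      rw [hedist, edist_comm a b, Subtype.edist_eq, edist_eq_enorm_sub, ← ofReal_norm,
        show (M.toNNReal : ENNReal) = ENNReal.ofReal M from rfl, ← ENNReal.ofReal_mul hM.le]
      exact metricDist_le_mul_norm hsub hb a.2 b.2
    have : IsCompact (range f) := by
      have : CompactSpace (Metric.closedBall p.val r) :=
        isCompact_iff_compactSpace.1 (isCompact_closedBall _ _)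
      exact isCompact_range hf.continuous
    convert this using 1
    ext q
    constructor
    · intro hq
      exact ⟨⟨q.val, hq⟩, rfl⟩
    · rintro ⟨a, rfl⟩
      exact a.2
  have : WeaklyLocallyCompactSpace (DomainPoint Ω) := ⟨fun p => by
    obtain ⟨r, m, M, hr, hm, hM, hsub, hb⟩ := hloc p
    exact ⟨_, hmk p r M hr hM hsub fun z hz v => (hb z hz v).2,
      hval.continuousAt.preimage_mem_nhds (Metric.closedBall_mem_nhds _ hr)⟩⟩
  have : CompleteSpace (DomainPoint Ω) := by
    refine EMetric.complete_of_cauchySeq_tendsto fun u hu => ?_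
    obtain ⟨p, hp, hlim⟩ := hc (fun k => (u k).val) (fun k => (u k).mem)
      fun ε hε => EMetric.cauchySeq_iff.1 hu ε hε
    exact ⟨⟨p, hp⟩, tendsto_iff_edist_tendsto_0.2 hlim⟩
  have hcomp := isCompact_closedEBall_of_complete (⟨o, ho⟩ : DomainPoint Ω)
    (fun p S ε hS hε hlt => by
      obtain ⟨y, hy, h1, h2⟩ := exists_intermediate_point hk hS hε hlt
      exact ⟨⟨y, hy⟩, h1, h2⟩) R
  convert hcomp.image hval using 1
  ext z
  constructor
  · rintro ⟨hz, hle⟩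
    exact ⟨⟨z, hz⟩, hle, rfl⟩
  · rintro ⟨p, hp, rfl⟩
    exact ⟨p.mem, hp⟩

end KahlerBall

end

/-! ### Cutoff functions built from the distance. -/

noncomputable section

namespace KahlerBall

open MeasureTheory Set

variable {n : ℕ} {g : Coeffs n} {Ω : Set (Cn n)} {z x y w : Cn n}

theorem closedBall_subset_unitBall {ρ : ℝ} (hρ : ρ < 1) :
    Metric.closedBall (0 : Cn n) ρ ⊆ unitBall n := Metric.closedBall_subset_ball hρ

theorem metricDist_zero_ne_top (hk : IsKahlerMetricOn g (unitBall n)) (hz : z ∈ unitBall n) :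
    metricDist g (unitBall n) z 0 ≠ ⊤ := by
  have hz1 : ‖z‖ < 1 := by simpa [unitBall] using hz
  obtain ⟨m, M, -, -, hb⟩ := hk.exists_vecLength_bounds
    (isCompact_closedBall (0 : Cn n) ‖z‖) (closedBall_subset_unitBall hz1)
  exact ne_top_of_le_ne_top ENNReal.ofReal_ne_top
    (metricDist_le_mul_norm (closedBall_subset_unitBall hz1) (fun z hz v => (hb z hz v).2)
      (by simp) (by simp))

/-- The cutoff function equal to `1` on the metric ball of radius `R` and to `0` outside the one
of radius `2R`. -/
def metricCutoff (g : Coeffs n) (R : ℝ) (z : Cn n) : ℝ :=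
  open Classical in
  if z ∈ unitBall n then max 0 (min 1 (2 - (metricDist g (unitBall n) z 0).toReal / R)) else 0

theorem metricCutoff_nonneg (R : ℝ) : 0 ≤ metricCutoff g R z := by
  unfold metricCutoff; split_ifs <;> simp

theorem metricCutoff_le_one (R : ℝ) : metricCutoff g R z ≤ 1 := by
  unfold metricCutoff; split_ifs <;> simp

theorem metricCutoff_eq_one {R : ℝ} (hR : 0 < R) (hz : z ∈ unitBall n)
    (h : metricDist g (unitBall n) z 0 ≤ ENNReal.ofReal R) : metricCutoff g R z = 1 := by
  have h1 : (metricDist g (unitBall n) z 0).toReal ≤ R := ENNReal.toReal_le_of_le_ofReal hR.le h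
  have h2 : (metricDist g (unitBall n) z 0).toReal / R ≤ 1 := (div_le_one hR).2 h1
  rw [metricCutoff, if_pos hz, min_eq_left (by linarith), max_eq_right zero_le_one]

theorem support_metricCutoff_subset (hk : IsKahlerMetricOn g (unitBall n)) {R : ℝ} (hR : 0 < R) :
    Function.support (metricCutoff g R) ⊆
      {z ∈ unitBall n | metricDist g (unitBall n) z 0 ≤ ENNReal.ofReal (2 * R)} := by
  intro z hz
  rw [Function.mem_support, metricCutoff] at hz
  split_ifs at hz with hzB
  · refine ⟨hzB, ?_⟩
    by_contra! hlt
    have h1 : 2 * R ≤ (metricDist g (unitBall n) z 0).toReal :=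
      ENNReal.ofReal_le_iff_le_toReal (metricDist_zero_ne_top hk hzB) |>.1 hlt.le
    have h2 : 2 ≤ (metricDist g (unitBall n) z 0).toReal / R := (le_div_iff₀ hR).2 h1
    exact hz (max_eq_left ((min_le_right _ _).trans (by linarith)))
  · exact absurd rfl hz

theorem abs_metricCutoff_sub_le (hk : IsKahlerMetricOn g (unitBall n)) {R b : ℝ} (hR : 0 < R)
    (hb : 0 ≤ b) (hx : x ∈ unitBall n) (hy : y ∈ unitBall n)
    (hxy : metricDist g (unitBall n) x y ≤ ENNReal.ofReal b) :
    |metricCutoff g R x - metricCutoff g R y| ≤ b / R := by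
  have key : ∀ p q, p ∈ unitBall n → q ∈ unitBall n →
      metricDist g (unitBall n) p q ≤ ENNReal.ofReal b →
      (metricDist g (unitBall n) p 0).toReal ≤ (metricDist g (unitBall n) q 0).toReal + b := by
    intro p q hp hq hpq
    have h1 := (metricDist_triangle hk (x := p) (y := q) (w := 0)).trans (add_le_add_left hpq _)
    have h2 := ENNReal.toReal_mono
      (ENNReal.add_ne_top.2 ⟨ENNReal.ofReal_ne_top, metricDist_zero_ne_top hk hq⟩) h1
    rw [ENNReal.toReal_add ENNReal.ofReal_ne_top (metricDist_zero_ne_top hk hq),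
      ENNReal.toReal_ofReal hb] at h2
    linarith
  have h1 := key x y hx hy hxy
  have h2 := key y x hy hx (by rwa [metricDist_comm hk])
  simp only [metricCutoff, if_pos hx, if_pos hy]
  set a := (metricDist g (unitBall n) x 0).toReal
  set a' := (metricDist g (unitBall n) y 0).toReal
  calc _ ≤ |min 1 (2 - a / R) - min 1 (2 - a' / R)| := by
        have := abs_max_sub_max_le_abs (min 1 (2 - a / R)) (min 1 (2 - a' / R)) 0
        simpa only [max_comm (0 : ℝ)] using this
    _ ≤ |(2 - a / R) - (2 - a' / R)| := by
        have := abs_min_sub_min_le_max 1 (2 - a / R) 1 (2 - a' / R)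
        simpa using this
    _ = |a' - a| / R := by
        rw [← abs_of_pos hR, ← abs_div, abs_of_pos hR]; congr 1; ring
    _ ≤ b / R := by
        gcongr
        rw [abs_le]; constructor <;> linarith

/-- Completeness enters the proof here: the metric ball of radius `2R` is compact, hence lies in a
Euclidean ball of radius `ρ' < 1`. Two points within radius `ρ` are compared by a segment, for some
`ρ' < ρ < 1`. If one point is outside radius `ρ`, the cutoff vanishes there, and it vanishes at the
other point too unless the two are at least `ρ - ρ'` apart. -/
theorem exists_lipschitzWith_metricCutoff (hk : IsKahlerMetricOn g (unitBall n))
    (hc : IsCompleteOn g (unitBall n)) {R : ℝ} (hR : 0 < R) :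
    (∃ C, LipschitzWith C (metricCutoff g R)) ∧ HasCompactSupport (metricCutoff g R) ∧
      tsupport (metricCutoff g R) ⊆ unitBall n := by
  set C := {z ∈ unitBall n | metricDist g (unitBall n) z 0 ≤ ENNReal.ofReal (2 * R)}
  have h0 : (0 : Cn n) ∈ unitBall n := by simp [unitBall]
  have hC : IsCompact C := hk.isCompact_metricBall isOpen_unitBall hc h0 (2 * R)
  have hsupp := support_metricCutoff_subset hk hR
  have hts : tsupport (metricCutoff g R) ⊆ C := closure_minimal hsupp hC.isClosed
  refine ⟨?_, hC.of_isClosed_subset (isClosed_tsupport _) hts, hts.trans fun z hz => hz.1⟩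
  obtain ⟨ρ', hρ', hCρ⟩ := exists_lt_subset_ball hC.isClosed
    (show C ⊆ Metric.ball 0 1 from fun z hz => hz.1)
  obtain ⟨ρ, hρ1, hρ2⟩ := exists_between hρ'
  obtain ⟨m, M, -, hM, hb⟩ := hk.exists_vecLength_bounds
    (isCompact_closedBall (0 : Cn n) ρ) (closedBall_subset_unitBall hρ2)
  have hout : ∀ p q : Cn n, q ∉ Metric.closedBall (0 : Cn n) ρ →
      |metricCutoff g R p - metricCutoff g R q| ≤ 1 / (ρ - ρ') * ‖p - q‖ := by
    intro p q hq
    have hsub : C ⊆ Metric.closedBall 0 ρ :=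
      hCρ.trans (Metric.ball_subset_closedBall.trans (Metric.closedBall_subset_closedBall hρ1.le))
    have hq0 : metricCutoff g R q = 0 := by
      by_contra hne
      exact hq (hsub (hsupp hne))
    have hpos : 0 < ρ - ρ' := by linarith
    rw [hq0, sub_zero, abs_of_nonneg (metricCutoff_nonneg R)]
    by_cases hp : metricCutoff g R p = 0
    · rw [hp]; positivity
    · have hp1 : ‖p‖ < ρ' := by simpa using hCρ (hsupp hp)
      have hq1 : ρ < ‖q‖ := by simpa using hq
      refine (metricCutoff_le_one R).trans ?_
      rw [one_div, inv_mul_eq_div, le_div_iff₀ hpos]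
      have := norm_sub_norm_le q p
      rw [norm_sub_rev] at this
      linarith
  refine ⟨_, LipschitzWith.of_dist_le' (K := max (M / R) (1 / (ρ - ρ'))) fun p q => ?_⟩
  rw [Real.dist_eq, dist_eq_norm]
  by_cases hq : q ∈ Metric.closedBall (0 : Cn n) ρ
  · by_cases hp : p ∈ Metric.closedBall (0 : Cn n) ρ
    · have h1 := abs_metricCutoff_sub_le hk hR (by positivity)
        (closedBall_subset_unitBall hρ2 hp) (closedBall_subset_unitBall hρ2 hq)
        (metricDist_le_mul_norm (closedBall_subset_unitBall hρ2)
          (fun z hz v => (hb z hz v).2) hp hq)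
      calc _ ≤ M * ‖q - p‖ / R := h1
        _ = M / R * ‖p - q‖ := by rw [norm_sub_rev]; ring
        _ ≤ _ := by gcongr; exact le_max_left _ _
    · rw [abs_sub_comm, norm_sub_rev]
      exact (hout q p hp).trans (by gcongr; exact le_max_right _ _)
  · exact (hout p q hq).trans (by gcongr; exact le_max_right _ _)

/-- The cutoff is `1 / R`-Lipschitz for the metric distance, and by continuity of `g` the segment
from `z` to `z + t v` has length at most `|t| (|v|_g + ε)` for small `t`. -/
theorem abs_fderiv_metricCutoff_le (hk : IsKahlerMetricOn g (unitBall n)) {R : ℝ} (hR : 0 < R)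
    (hz : z ∈ unitBall n) (hd : DifferentiableAt ℝ (metricCutoff g R) z) (v : Cn n) :
    |fderiv ℝ (metricCutoff g R) z v| ≤ vecLength g z v / R := by
  have main : ∀ ε > 0, |fderiv ℝ (metricCutoff g R) z v| ≤ (vecLength g z v + ε) / R := by
    intro ε hε
    have hcont : ContinuousAt (fun w => vecLength g w v) z := by
      have h1 : ContinuousOn (fun w : Cn n => (w, v)) (unitBall n) := by fun_prop
      have h2 := ContinuousOn.comp hk.continuousOn_vecLength h1 fun w hw => ⟨hw, mem_univ _⟩
      exact h2.continuousAt (isOpen_unitBall.mem_nhds hz)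
    have hev : ∀ᶠ w in nhds z, w ∈ unitBall n ∧ vecLength g w v < vecLength g z v + ε :=
      (isOpen_unitBall.eventually_mem hz).and
        (hcont.eventually_lt continuousAt_const (by linarith))
    obtain ⟨r, hr, hball⟩ := Metric.nhds_basis_closedBall.mem_iff.1 hev
    have hγ : HasDerivAt (fun t : ℝ => z + t • v) v 0 := by
      convert! ((hasDerivAt_id (0 : ℝ)).smul_const v).const_add z using 1
      simp
    have hder : HasDerivAt (fun t : ℝ => metricCutoff g R (z + t • v))
        (fderiv ℝ (metricCutoff g R) z v) 0 :=
      hd.hasFDerivAt.comp_hasDerivAt_of_eq (0 : ℝ) hγ (by simp)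
    have hnn : 0 ≤ vecLength g z v + ε := by linarith [vecLength_nonneg (g := g) (z := z) v]
    refine hder.le_of_lip' (by positivity) ?_
    have hnear : ∀ᶠ t : ℝ in nhds 0, z + t • v ∈ Metric.closedBall z r := by
      have : Filter.Tendsto (fun t : ℝ => z + t • v) (nhds 0) (nhds z) := by
        simpa using hγ.continuousAt.tendsto
      exact this.eventually (Metric.closedBall_mem_nhds z hr)
    filter_upwards [hnear] with t ht
    have hz' : z ∈ Metric.closedBall z r := Metric.mem_closedBall_self hr.le
    have h1 : metricDist g (unitBall n) z (z + t • v)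
        ≤ ENNReal.ofReal (|t| * (vecLength g z v + ε)) := by
      refine metricDist_le_of_segment
        (fun s hs => (hball (mem_closedBall_segment hz' ht hs)).1) fun s hs => ?_
      have h2 := (hball (mem_closedBall_segment hz' ht hs)).2
      rw [add_sub_cancel_left] at h2 ⊢
      rw [vecLength_smul]
      gcongr
    have h3 := abs_metricCutoff_sub_le hk hR (by positivity) hz (hball ht).1 h1
    rw [abs_sub_comm] at h3
    simpa [Real.norm_eq_abs, mul_comm, mul_div_assoc] using h3
  refine le_of_forall_pos_le_add fun ε hε => ?_
  have := main (ε * R) (by positivity)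
  rwa [add_div, mul_div_cancel_right₀ _ hR.ne'] at this

end KahlerBall

end

/-! ### The divergence theorem for compactly supported Lipschitz fields. -/

noncomputable section

namespace KahlerBall

open MeasureTheory Set

theorem integrable_lineDeriv_of_lipschitzWith {E : Type*} [NormedAddCommGroup E]
    [NormedSpace ℝ E] [FiniteDimensional ℝ E] [MeasurableSpace E] [BorelSpace E]
    {μ : Measure E} [μ.IsAddHaarMeasure] {f : E → ℝ} {C : NNReal}
    (hf : LipschitzWith C f) (hc : HasCompactSupport f) (v : E) :
    Integrable (fun x => lineDeriv ℝ f x v) μ := by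
  have h1 : IntegrableOn (fun x => lineDeriv ℝ f x v) (tsupport f) μ :=
    (hf.locallyIntegrable_lineDeriv v).integrableOn_isCompact hc
  refine (integrableOn_iff_integrable_of_support_subset fun x hx => ?_).1 h1
  by_contra hcon
  refine hx ?_
  have h0 : f =ᶠ[nhds x] fun _ => 0 := notMem_tsupport_iff_eventuallyEq.1 hcon
  have h1 : lineDeriv ℝ f x v = lineDeriv ℝ (fun _ => (0 : ℝ)) x v := h0.lineDeriv_eq
  simpa [lineDeriv] using h1

/-- Integration by parts against the constant function `1`. The Lipschitz class is what makes
smoothing the distance function unnecessary. -/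
theorem integral_lineDeriv_eq_zero_of_lipschitzWith {E : Type*} [NormedAddCommGroup E]
    [NormedSpace ℝ E] [FiniteDimensional ℝ E] [MeasurableSpace E] [BorelSpace E]
    {μ : Measure E} [μ.IsAddHaarMeasure] {f : E → ℝ} {C : NNReal}
    (hf : LipschitzWith C f) (hc : HasCompactSupport f) (v : E) :
    ∫ x, lineDeriv ℝ f x v ∂μ = 0 := by
  have := (LipschitzWith.const (1 : ℝ) (α := E)).integral_lineDeriv_mul_eq (μ := μ) hf hc (-v)
  simpa [lineDeriv] using this.symm

theorem exists_lipschitzWith_mul {E : Type*} [PseudoMetricSpace E] {f g : E → ℂ}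
    {C D : NNReal} {a b : ℝ}
    (hf : LipschitzWith C f) (hg : LipschitzWith D g) (ha : ∀ x, ‖f x‖ ≤ a)
    (hb : ∀ x, ‖g x‖ ≤ b) : ∃ L, LipschitzWith L (fun x => f x * g x) := by
  refine ⟨_, LipschitzWith.of_dist_le' (K := a * D + b * C) fun x y => ?_⟩
  rw [dist_eq_norm]
  have h1 : ‖f x - f y‖ ≤ C * dist x y := by rw [← dist_eq_norm]; exact hf.dist_le_mul x y
  have h2 : ‖g x - g y‖ ≤ D * dist x y := by rw [← dist_eq_norm]; exact hg.dist_le_mul x y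
  have ha0 : 0 ≤ a := (norm_nonneg _).trans (ha x)
  have hb0 : 0 ≤ b := (norm_nonneg _).trans (hb x)
  calc ‖f x * g x - f y * g y‖ = ‖f x * (g x - g y) + (f x - f y) * g y‖ := by congr 1; ring
    _ ≤ ‖f x‖ * ‖g x - g y‖ + ‖f x - f y‖ * ‖g y‖ := by
        refine (norm_add_le _ _).trans ?_
        rw [norm_mul, norm_mul]
    _ ≤ a * (D * dist x y) + C * dist x y * b := by
        gcongr
        · exact ha x
        · exact hb y
    _ = _ := by ring

variable {n : ℕ}

/-- The integral of the `∂̄`-divergence of a compactly supported Lipschitz field vanishes. -/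
theorem integrable_and_integral_re_sum_dzbar_eq_zero {F : Fin n → Cn n → ℂ} {C : Fin n → NNReal}
    (hF : ∀ β, LipschitzWith (C β) (F β)) (hc : ∀ β, HasCompactSupport (F β)) :
    Integrable (fun z => (∑ β, dzbar β (F β) z).re) ∧
      ∫ z, (∑ β, dzbar β (F β) z).re = 0 := by
  have hre : ∀ β, LipschitzWith (1 * C β) (fun z => (F β z).re) := fun β =>
    (Complex.reCLM.lipschitz.weaken (by simp)).comp (hF β)
  have him : ∀ β, LipschitzWith (1 * C β) (fun z => (F β z).im) := fun β =>
    (Complex.imCLM.lipschitz.weaken (by simp)).comp (hF β)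
  have hrec : ∀ β, HasCompactSupport (fun z => (F β z).re) := fun β =>
    (hc β).comp_left (g := Complex.re) rfl
  have himc : ∀ β, HasCompactSupport (fun z => (F β z).im) := fun β =>
    (hc β).comp_left (g := Complex.im) rfl
  -- By Rademacher's theorem the fields are differentiable almost everywhere, and there the
  -- divergence is a combination of real line derivatives.
  have hae : (fun z => (∑ β, dzbar β (F β) z).re) =ᵐ[volume] fun z => ∑ β,
      (lineDeriv ℝ (fun z => (F β z).re) z (stdVec β)
        - lineDeriv ℝ (fun z => (F β z).im) z (Complex.I • stdVec β)) / 2 := by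
    have hall : ∀ᵐ z, ∀ β, DifferentiableAt ℝ (F β) z :=
      ae_all_iff.2 fun β => (hF β).ae_differentiableAt
    filter_upwards [hall] with z hz
    rw [Complex.re_sum]
    refine Finset.sum_congr rfl fun β _ => ?_
    have h1 := (Complex.reCLM.hasFDerivAt.comp z (hz β).hasFDerivAt)
    have h2 := (Complex.imCLM.hasFDerivAt.comp z (hz β).hasFDerivAt)
    have e1 : lineDeriv ℝ (fun z => (F β z).re) z (stdVec β)
        = (fderiv ℝ (F β) z (stdVec β)).re := (h1.hasLineDerivAt _).lineDeriv
    have e2 : lineDeriv ℝ (fun z => (F β z).im) z (Complex.I • stdVec β)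
        = (fderiv ℝ (F β) z (Complex.I • stdVec β)).im := (h2.hasLineDerivAt _).lineDeriv
    rw [e1, e2, dzbar]
    simp [sub_eq_add_neg]
  have hi1 := fun β => integrable_lineDeriv_of_lipschitzWith (μ := volume) (hre β) (hrec β) (stdVec β)
  have hi2 := fun β => integrable_lineDeriv_of_lipschitzWith (μ := volume) (him β) (himc β)
    (Complex.I • stdVec β)
  have hi3 : ∀ β, Integrable (fun z => (lineDeriv ℝ (fun z => (F β z).re) z (stdVec β)
      - lineDeriv ℝ (fun z => (F β z).im) z (Complex.I • stdVec β)) / 2) :=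
    fun β => ((hi1 β).sub (hi2 β)).div_const 2
  refine ⟨(integrable_finsetSum _ fun β _ => hi3 β).congr hae.symm, ?_⟩
  rw [integral_congr_ae hae, integral_finsetSum _ fun β _ => hi3 β]
  refine Finset.sum_eq_zero fun β _ => ?_
  rw [integral_div, integral_sub (hi1 β) (hi2 β),
    integral_lineDeriv_eq_zero_of_lipschitzWith (hre β) (hrec β),
    integral_lineDeriv_eq_zero_of_lipschitzWith (him β) (himc β)]
  simp

end KahlerBall

end

/-! ### The integrated estimate and the conclusion. -/

noncomputable section

namespace KahlerBall

open MeasureTheory Set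

variable {n : ℕ} {g : Coeffs n} {z : Cn n} {φ : Cn n → ℝ}

/-- A smooth function on the ball times a squared metric cutoff is globally Lipschitz. -/
theorem exists_lipschitzWith_metricCutoff_sq_mul (hk : IsKahlerMetricOn g (unitBall n))
    (hc : IsCompleteOn g (unitBall n)) {R : ℝ} (hR : 0 < R) {W : Cn n → ℂ}
    (hW : ContDiffOn ℝ ∞ W (unitBall n)) :
    ∃ L, LipschitzWith L (fun z => ((metricCutoff g R z : ℂ) * metricCutoff g R z) * W z) := by
  obtain ⟨⟨C, hC⟩, hcs, hts⟩ := exists_lipschitzWith_metricCutoff hk hc hR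
  obtain ⟨ρ₀, hρ₀, hsub⟩ := exists_lt_subset_ball (isClosed_tsupport _)
    (show tsupport (metricCutoff g R) ⊆ Metric.ball 0 1 from hts)
  -- `W` is arbitrary outside the ball and may blow up at its boundary. It is replaced by its
  -- product `V` with a bump equal to `1` on the support of the cutoff, which changes nothing in the
  -- product. The maximum with `0` makes the bump radius positive.
  obtain ⟨ρ, hρ, hρ1⟩ := exists_between (max_lt hρ₀ zero_lt_one)
  obtain ⟨ρ', hρ', hρ1'⟩ := exists_between hρ1
  let χ : ContDiffBump (0 : Cn n) := ⟨ρ, ρ', (le_max_right _ _).trans_lt hρ, hρ'⟩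
  set V : Cn n → ℂ := fun z => (χ z : ℂ) * W z
  have hχc : ContDiff ℝ ∞ (fun z => (χ z : ℂ)) := Complex.ofRealCLM.contDiff.comp χ.contDiff
  have hVs : tsupport V ⊆ Metric.closedBall 0 ρ' := by
    refine closure_minimal (fun z hz => ?_) Metric.isClosed_closedBall
    have h1 : χ z ≠ 0 := fun h => hz (by simp [V, h])
    have h2 : z ∈ Function.support χ := h1
    rw [χ.support_eq] at h2
    exact Metric.ball_subset_closedBall h2
  have hVc : HasCompactSupport V :=
    (isCompact_closedBall _ _).of_isClosed_subset (isClosed_tsupport _) hVs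
  have hV : ContDiff ℝ 1 V := by
    refine contDiff_iff_contDiffAt.2 fun z => ?_
    by_cases hz : z ∈ tsupport V
    swap
    · exact contDiffAt_const.congr_of_eventuallyEq (notMem_tsupport_iff_eventuallyEq.1 hz)
    have hzB : z ∈ unitBall n := closedBall_subset_unitBall hρ1' (hVs hz)
    exact ((hχc.contDiffAt.mul (hW.contDiffAt (isOpen_unitBall.mem_nhds hzB))).of_le (by simp))
  obtain ⟨D, hD⟩ := hV.lipschitzWith_of_hasCompactSupport hVc (by simp)
  obtain ⟨b, hb⟩ := hVc.exists_bound_of_continuous hV.continuous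
  have hζ : LipschitzWith (1 * C) (fun z => (metricCutoff g R z : ℂ)) :=
    (Complex.isometry_ofReal.lipschitz).comp hC
  have hζ1 : ∀ z, ‖(metricCutoff g R z : ℂ)‖ ≤ 1 := fun z => by
    rw [Complex.norm_real, Real.norm_of_nonneg (metricCutoff_nonneg R)]
    exact metricCutoff_le_one R
  obtain ⟨C', hC'⟩ := exists_lipschitzWith_mul hζ hζ hζ1 hζ1
  obtain ⟨L, hL⟩ := exists_lipschitzWith_mul hC' hD (a := 1) (fun z => by
    rw [norm_mul]; exact mul_le_one₀ (hζ1 z) (norm_nonneg _) (hζ1 z)) hb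
  have e : ∀ z, ((metricCutoff g R z : ℂ) * metricCutoff g R z) * W z
      = ((metricCutoff g R z : ℂ) * metricCutoff g R z) * V z := fun z => ?_
  · exact ⟨L, by simpa only [e] using hL⟩
  by_cases hz : metricCutoff g R z = 0
  · simp [hz]
  · have h1 : z ∈ Metric.closedBall (0 : Cn n) ρ := by
      have := hsub (subset_tsupport _ hz)
      rw [mem_ball_zero_iff] at this
      rw [mem_closedBall_zero_iff]
      exact (this.le.trans (le_max_left _ _)).trans hρ.le
    have h2 : χ z = 1 := χ.one_of_mem_closedBall h1
    simp [V, h2]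

/-- The squared length of the test field. -/
theorem vecLength_conj_testField (hk : IsKahlerMetricOn g (unitBall n)) (hz : z ∈ unitBall n)
    (θ c : ℝ) :
    vecLength g z (WithLp.toLp 2 fun β => (starRingEnd ℂ) (testField g φ θ c β z))
      = Real.exp (θ * φ z) * Real.sqrt (coForm g z
        (fun α => traceConn g α z - c * delta φ z α)
        (fun α => traceConn g α z - c * delta φ z α)).re := by
  set f : Fin n → ℂ := fun α => traceConn g α z - c * delta φ z α
  have hlow : lower g z (WithLp.toLp 2 fun β => (starRingEnd ℂ) (testField g φ θ c β z))
      = fun β => ((Real.exp (θ * φ z) : ℝ) : ℂ) * f β := by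
    ext β
    simp only [lower, Complex.conj_conj, testField]
    calc _ = Complex.exp (θ * φ z) * ∑ α, (∑ γ, g z β γ * invCoeff g z α γ) * f α := by
          simp only [Finset.mul_sum, Finset.sum_mul]
          rw [Finset.sum_comm]
          exact Finset.sum_congr rfl fun γ _ => Finset.sum_congr rfl fun α _ => by ring
      _ = _ := by simp [hk.sum_mul_invCoeff hz]
  rw [vecLength_eq, ← hk.coForm_lower_lower hz, hlow, coForm_smul_left,
    hk.coForm_real_smul_right hz, Complex.re_ofReal_mul, Complex.re_ofReal_mul, ← mul_assoc,
    Real.sqrt_mul (mul_self_nonneg _), Real.sqrt_mul_self (Real.exp_pos _).le]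

/-- The sum is the conjugate of `∂ζ` applied to the vector `v` with components `conj W^β`. Its real
part is half of `dζ(v)`, whence the factor `2` in the denominator. -/
theorem abs_re_sum_dzbar_cutoff_mul_le (hk : IsKahlerMetricOn g (unitBall n)) {R : ℝ}
    (hR : 0 < R) (hz : z ∈ unitBall n) (hd : DifferentiableAt ℝ (metricCutoff g R) z)
    (θ c : ℝ) :
    (∑ β, dzbar β (fun w => (metricCutoff g R w : ℂ)) z * testField g φ θ c β z).re
      ≤ Real.exp (θ * φ z) * Real.sqrt (coForm g z
        (fun α => traceConn g α z - c * delta φ z α)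
        (fun α => traceConn g α z - c * delta φ z α)).re / (2 * R) := by
  set v : Cn n := WithLp.toLp 2 fun β => (starRingEnd ℂ) (testField g φ θ c β z)
  have h1 : ∑ β, dzbar β (fun w => (metricCutoff g R w : ℂ)) z * testField g φ θ c β z
      = (starRingEnd ℂ) (∑ β, dz β (fun w => (metricCutoff g R w : ℂ)) z * v β) := by
    rw [map_sum]
    refine Finset.sum_congr rfl fun β _ => ?_
    rw [map_mul, dzbar_ofReal]
    simp [v]
  have h2 : (((fderiv ℝ (metricCutoff g R) z v : ℝ) : ℂ)
      - Complex.I * (fderiv ℝ (metricCutoff g R) z (Complex.I • v) : ℝ)) / 2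
      = ((fderiv ℝ (metricCutoff g R) z v / 2 : ℝ) : ℂ)
        + ((-fderiv ℝ (metricCutoff g R) z (Complex.I • v) / 2 : ℝ) : ℂ) * Complex.I := by
    push_cast; ring
  have h3 := (le_abs_self _).trans (abs_fderiv_metricCutoff_le hk hR hz hd v)
  rw [vecLength_conj_testField hk hz] at h3
  rw [h1, sum_dz_ofReal_mul hd, h2, Complex.conj_re, Complex.add_re, Complex.re_ofReal_mul,
    Complex.I_re, mul_zero, add_zero, Complex.ofReal_re]
  calc _ ≤ _ := div_le_div_of_nonneg_right h3 zero_le_two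
    _ = _ := by rw [div_div, mul_comm R]

/-- The pointwise bound on the divergence of the cut-off test field. -/
theorem re_sum_dzbar_cutoff_sq_mul_le (hk : IsKahlerMetricOn g (unitBall n))
    (hφ : IsPotentialOn g (unitBall n) φ) {K A R : ℝ} (hR : 1 ≤ R) (hz : z ∈ unitBall n)
    (hA : gradLengthSq g φ z ≤ A) (hE : ∀ α β, ricci g α β z = -(K : ℂ) * g z α β)
    (hd : DifferentiableAt ℝ (metricCutoff g R) z) (θ s : ℝ) :
    (∑ β, dzbar β (fun w => ((metricCutoff g R w : ℂ) * metricCutoff g R w)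
        * testField g φ θ (θ + 2 * s) β w) z).re
      ≤ Real.exp (θ * φ z) * (metricCutoff g R z ^ 2 * ((K - θ - 2 * s) * n + s ^ 2 * A)
        + (1 / 2 + s ^ 2 * A) / R) := by
  set ζ := metricCutoff g R z with hζ
  have hζ0 : 0 ≤ ζ := metricCutoff_nonneg R
  have hζ1 : ζ ≤ 1 := metricCutoff_le_one R
  have hR0 : 0 < R := by linarith
  have hdc : DifferentiableAt ℝ (fun w => (metricCutoff g R w : ℂ)) z :=
    Complex.ofRealCLM.differentiableAt.comp z hd
  have hW : ∀ β, DifferentiableAt ℝ (testField g φ θ (θ + 2 * s) β) z := fun β =>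
    differentiableAt_of_contDiffOn isOpen_unitBall
      (contDiffOn_testField isOpen_unitBall hk hφ θ _ β) hz
  have e : ∑ β, dzbar β (fun w => ((metricCutoff g R w : ℂ) * metricCutoff g R w)
        * testField g φ θ (θ + 2 * s) β w) z
      = ((ζ ^ 2 : ℝ) : ℂ) * ∑ β, dzbar β (testField g φ θ (θ + 2 * s) β) z
        + ((2 * ζ : ℝ) : ℂ) * ∑ β, dzbar β (fun w => (metricCutoff g R w : ℂ)) z
          * testField g φ θ (θ + 2 * s) β z := by
    rw [Finset.mul_sum, Finset.mul_sum, ← Finset.sum_add_distrib]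
    refine Finset.sum_congr rfl fun β _ => ?_
    rw [dzbar_mul (hdc.fun_mul hdc) (hW β), dzbar_mul hdc hdc]
    push_cast
    ring
  rw [e, Complex.add_re, Complex.re_ofReal_mul, Complex.re_ofReal_mul]
  have b1 := re_sum_dzbar_testField_le isOpen_unitBall hk hφ hA hz hE θ s
  have b2 := abs_re_sum_dzbar_cutoff_mul_le (φ := φ) hk hR0 hz hd θ (θ + 2 * s)
  set Y : Fin n → ℂ := fun α => traceConn g α z - (θ + s) * delta φ z α
  have hf : (fun α => traceConn g α z - ((θ + 2 * s : ℝ) : ℂ) * delta φ z α)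
      = fun α => Y α + ((-s : ℝ) : ℂ) * delta φ z α := by
    ext α; simp only [Y]; push_cast; ring
  have b3 := hk.re_coForm_add_le hz s Y (delta φ z)
  rw [← gradLengthSq_eq] at b3
  rw [hf] at b2
  set N := (coForm g z (fun α => Y α + ((-s : ℝ) : ℂ) * delta φ z α)
    (fun α => Y α + ((-s : ℝ) : ℂ) * delta φ z α)).re
  have hN0 : 0 ≤ N := hk.coForm_self_nonneg hz _
  set h := (coForm g z Y Y).re
  have hh0 : 0 ≤ h := hk.coForm_self_nonneg hz _
  set E := Real.exp (θ * φ z)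
  have hE0 : 0 < E := Real.exp_pos _
  have hA0 : 0 ≤ A := le_trans (by rw [gradLengthSq_eq]; exact hk.coForm_self_nonneg hz _) hA
  have hN : N ≤ 2 * h + 2 * s ^ 2 * A := by nlinarith [mul_le_mul_of_nonneg_left hA (sq_nonneg s)]
  -- The cutoff is squared so that the cross term keeps a factor `ζ`. Then `2 ζ √N ≤ ζ² N + 1`, and
  -- the part `ζ² |Y|²` of `ζ² N / 2` is absorbed by the divergence term; `R ≥ 1` makes its
  -- coefficient `1 / R` small enough.
  have b4 : ζ * Real.sqrt N ≤ ζ ^ 2 * h + s ^ 2 * A + 1 / 2 := by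
    have h1 : ζ * Real.sqrt N ≤ (ζ ^ 2 * N + 1) / 2 := by
      nlinarith [sq_nonneg (ζ * Real.sqrt N - 1), Real.sq_sqrt hN0]
    have h2 : ζ ^ 2 * N ≤ ζ ^ 2 * (2 * h + 2 * s ^ 2 * A) := by gcongr
    have h3 : ζ ^ 2 * (s ^ 2 * A) ≤ 1 * (s ^ 2 * A) := by
      gcongr
      exact pow_le_one₀ hζ0 hζ1
    nlinarith
  have b5 : ζ * Real.sqrt N / R ≤ ζ ^ 2 * h + (1 / 2 + s ^ 2 * A) / R := by
    have h1 : ζ ^ 2 * h / R ≤ ζ ^ 2 * h := div_le_self (by positivity) hR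
    calc ζ * Real.sqrt N / R ≤ (ζ ^ 2 * h + s ^ 2 * A + 1 / 2) / R := by gcongr
      _ = ζ ^ 2 * h / R + (1 / 2 + s ^ 2 * A) / R := by ring
      _ ≤ _ := by linarith
  calc _ ≤ ζ ^ 2 * (E * ((K - θ - 2 * s) * n + s ^ 2 * A - h))
        + 2 * ζ * (E * Real.sqrt N / (2 * R)) := by gcongr
    _ = E * (ζ ^ 2 * ((K - θ - 2 * s) * n + s ^ 2 * A) - ζ ^ 2 * h + ζ * Real.sqrt N / R) := by
        field_simp
    _ ≤ _ := by
        exact mul_le_mul_of_nonneg_left (by linarith) hE0.le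

theorem exists_ball_subset_metricBall (hk : IsKahlerMetricOn g (unitBall n)) :
    ∃ r : ℝ, 0 < r ∧ Metric.ball (0 : Cn n) r ⊆ unitBall n ∧
      ∀ z ∈ Metric.ball (0 : Cn n) r, metricDist g (unitBall n) z 0 ≤ ENNReal.ofReal 1 := by
  obtain ⟨m, M, -, hM, hb⟩ := hk.exists_vecLength_bounds
    (isCompact_closedBall (0 : Cn n) (1 / 2)) (closedBall_subset_unitBall (by norm_num))
  have hsub : Metric.ball (0 : Cn n) (min (1 / 2) (1 / M)) ⊆ Metric.closedBall 0 (1 / 2) :=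
    Metric.ball_subset_closedBall.trans (Metric.closedBall_subset_closedBall (min_le_left _ _))
  refine ⟨min (1 / 2) (1 / M), by positivity, hsub.trans (closedBall_subset_unitBall (by norm_num)),
    fun z hz => ?_⟩
  have h1 := metricDist_le_mul_norm (closedBall_subset_unitBall (by norm_num))
    (fun z hz v => (hb z hz v).2) (hsub hz) (by simp : (0 : Cn n) ∈ Metric.closedBall 0 (1 / 2))
  refine h1.trans (ENNReal.ofReal_le_ofReal ?_)
  have h2 : ‖z‖ < 1 / M := lt_of_lt_of_le (by simpa using hz) (min_le_right _ _)
  rw [zero_sub, norm_neg]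
  rw [lt_div_iff₀ hM] at h2
  linarith

/-- The gradient of a potential of a complete Kähler-Einstein metric of the ball cannot be
uniformly smaller than `(n + 1) / K`. -/
theorem not_forall_gradLengthSq_le (hn : 1 ≤ n) {K A : ℝ}
    (hg : IsCompleteKahlerEinstein g (unitBall n) K) (hφ : IsPotentialOn g (unitBall n) φ)
    (hA : 0 < A) (hKA : K * A < n + 1) (hgrad : ∀ z ∈ unitBall n, gradLengthSq g φ z ≤ A) :
    False := by
  have hk := hg.kahler
  have hn0 : (0 : ℝ) < n := by exact_mod_cast hn
  -- The upper bound on `θ` gives integrability of the weight, the lower bound gives the sign of the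
  -- divergence. The interval is nonempty because `K - n / A < 1 / A` is `K A < n + 1`.
  obtain ⟨θ, hθ1, hθ2⟩ : ∃ θ, max 0 (K - n / A) < θ ∧ θ < 1 / A := by
    refine exists_between (max_lt (by positivity) ?_)
    rw [sub_lt_iff_lt_add, ← add_div, lt_div_iff₀ hA]
    linarith
  have hθ0 : 0 < θ := (le_max_left _ _).trans_lt hθ1
  have hθK : K - n / A < θ := (le_max_right _ _).trans_lt hθ1
  have hθA : θ * A < 1 := (lt_div_iff₀ hA).1 hθ2
  have hint := integrableOn_exp_potential hn hk hφ hA hθ0.le hθA hgrad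
  -- The minimizer of `s² A - 2 s n`, with minimum `-n² / A`.
  set s : ℝ := n / A
  set δ : ℝ := n * (n / A - K + θ)
  have hδ : 0 < δ := mul_pos hn0 (by linarith)
  have hδe : (K - θ - 2 * s) * n + s ^ 2 * A = -δ := by
    simp only [s, δ]; field_simp; ring
  set c : ℝ := 1 / 2 + s ^ 2 * A
  have hc0 : 0 < c := by positivity
  obtain ⟨r, hr, hrB, hrd⟩ := exists_ball_subset_metricBall hk
  set m := ∫ z in unitBall n, Real.exp (θ * φ z)
  set m₀ := ∫ z in Metric.ball (0 : Cn n) r, Real.exp (θ * φ z)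
  have hm₀ : 0 < m₀ := by
    refine (setIntegral_pos_iff_support_of_nonneg_ae
      (Filter.Eventually.of_forall fun z => (Real.exp_pos _).le) (hint.mono_set hrB)).2 ?_
    have : Function.support (fun z => Real.exp (θ * φ z)) = univ := by
      ext z; simp [(Real.exp_pos _).ne']
    rw [this, univ_inter]
    exact Metric.measure_ball_pos volume _ hr
  have main : ∀ R : ℝ, 1 ≤ R → δ * m₀ ≤ c / R * m := by
    intro R hR
    have hR0 : 0 < R := by linarith
    obtain ⟨⟨Cζ, hζL⟩, hζc, hζs⟩ := exists_lipschitzWith_metricCutoff hk hg.complete hR0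
    set F : Fin n → Cn n → ℂ := fun β w => ((metricCutoff g R w : ℂ) * metricCutoff g R w)
        * testField g φ θ (θ + 2 * s) β w
    have hFL : ∀ β, ∃ L, LipschitzWith L (F β) := fun β =>
      exists_lipschitzWith_metricCutoff_sq_mul hk hg.complete hR0
        (contDiffOn_testField isOpen_unitBall hk hφ θ _ β)
    choose L hL using hFL
    have hF0 : ∀ β z, metricCutoff g R z = 0 → F β z = 0 := fun β z hz => by simp [F, hz]
    have hFc : ∀ β, HasCompactSupport (F β) := fun β =>
      hζc.mono fun z hz h0 => hz (hF0 β z h0)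
    obtain ⟨hFi, hzero⟩ := integrable_and_integral_re_sum_dzbar_eq_zero hL hFc
    -- The closed support of the cutoff lies in the open ball, so the field vanishes near every
    -- point outside, the unit sphere included.
    have hout : ∀ z ∉ unitBall n, (∑ β, dzbar β (F β) z).re = 0 := fun z hz => by
      have h1 : metricCutoff g R =ᶠ[nhds z] 0 :=
        notMem_tsupport_iff_eventuallyEq.1 fun h => hz (hζs h)
      rw [Finset.sum_eq_zero fun β _ => ?_, Complex.zero_re]
      rw [← dzbar_const (z := z) 0 β]
      exact dzbar_congr (h1.mono fun w hw => hF0 β w hw) β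
    have hζm : Measurable (metricCutoff g R) := hζL.continuous.measurable
    have hζi : IntegrableOn (fun z => Real.exp (θ * φ z) * metricCutoff g R z ^ 2)
        (unitBall n) := by
      refine Integrable.mono hint (hint.1.mul (hζm.pow_const 2).aestronglyMeasurable)
        (Filter.Eventually.of_forall fun z => ?_)
      rw [norm_mul, norm_pow, Real.norm_of_nonneg (metricCutoff_nonneg R)]
      exact mul_le_of_le_one_right (norm_nonneg _)
        (pow_le_one₀ (metricCutoff_nonneg R) (metricCutoff_le_one R))
    have hbound : 0 ≤ ∫ z in unitBall n, (-δ * (Real.exp (θ * φ z) * metricCutoff g R z ^ 2)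
        + c / R * Real.exp (θ * φ z)) := by
      rw [← hzero, ← setIntegral_eq_integral_of_forall_compl_eq_zero (s := unitBall n) hout]
      refine setIntegral_mono_ae_restrict hFi.integrableOn
        ((hζi.const_mul _).add (hint.const_mul _)) ?_
      have hdiff := ae_restrict_of_ae (s := unitBall n) (hζL.ae_differentiableAt (μ := volume))
      filter_upwards [hdiff, ae_restrict_mem isOpen_unitBall.measurableSet] with z hd hz
      have := re_sum_dzbar_cutoff_sq_mul_le hk hφ hR hz (hgrad z hz) (hg.einstein z hz) hd θ s
      rw [hδe] at this
      refine this.trans_eq ?_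
      ring
    rw [integral_add (hζi.const_mul _) (hint.const_mul _), integral_const_mul,
      integral_const_mul] at hbound
    have hlow : m₀ ≤ ∫ z in unitBall n, Real.exp (θ * φ z) * metricCutoff g R z ^ 2 := by
      have h1 : m₀ = ∫ z in Metric.ball (0 : Cn n) r,
          Real.exp (θ * φ z) * metricCutoff g R z ^ 2 := by
        refine setIntegral_congr_fun Metric.isOpen_ball.measurableSet fun z hz => ?_
        have : metricCutoff g R z = 1 := metricCutoff_eq_one hR0 (hrB hz)
          ((hrd z hz).trans (ENNReal.ofReal_le_ofReal hR))
        simp [this]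
      rw [h1]
      exact setIntegral_mono_set hζi (Filter.Eventually.of_forall fun z =>
        mul_nonneg (Real.exp_pos _).le (sq_nonneg _)) (Filter.Eventually.of_forall hrB)
    nlinarith
  have hm : 0 ≤ m := integral_nonneg fun z => (Real.exp_pos _).le
  -- Neither `m` nor `m₀` depends on `R`. This choice makes the error `c m / R₀` at most half of `δ
  -- m₀`.
  set R₀ : ℝ := max 1 (2 * (c * m) / (δ * m₀))
  have hR₀ : 0 < R₀ := lt_of_lt_of_le zero_lt_one (le_max_left _ _)
  have h1 := main R₀ (le_max_left _ _)
  have h2 : 2 * (c * m) ≤ R₀ * (δ * m₀) := (div_le_iff₀ (by positivity)).1 (le_max_right _ _)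
  have h3 : δ * m₀ * R₀ ≤ c * m := by
    calc δ * m₀ * R₀ ≤ c / R₀ * m * R₀ := by gcongr
      _ = c * m := by field_simp
  have h4 : 0 < δ * m₀ * R₀ := by positivity
  nlinarith

end KahlerBall

end
theorem proposition4p1 (n : ℕ) (hn : 1 ≤ n) (K : ℝ) (hK : 0 < K)
    (g : KahlerBall.Coeffs n)
    (hg : KahlerBall.IsCompleteKahlerEinstein g (KahlerBall.unitBall n) K)
    (φ : KahlerBall.Cn n → ℝ)
    (hφ : KahlerBall.IsPotentialOn g (KahlerBall.unitBall n) φ) :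
    ((((n : ℝ) + 1) / K : ℝ) : EReal) ≤
      ⨆ z ∈ KahlerBall.unitBall n, ((KahlerBall.gradLengthSq g φ z : ℝ) : EReal) := by
  by_contra! hlt
  obtain ⟨A, hA1, hA2⟩ := EReal.lt_iff_exists_real_btwn.1 hlt
  have hgrad : ∀ z ∈ KahlerBall.unitBall n, KahlerBall.gradLengthSq g φ z < A := fun z hz =>
    EReal.coe_lt_coe_iff.1 ((le_iSup₂ (f := fun z (_ : z ∈ KahlerBall.unitBall n) =>
      ((KahlerBall.gradLengthSq g φ z : ℝ) : EReal)) z hz).trans_lt hA1)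
  have h0 : (0 : KahlerBall.Cn n) ∈ KahlerBall.unitBall n := by simp [KahlerBall.unitBall]
  -- The strict inequality at the origin gives positivity even when the gradient vanishes there.
  have hA : 0 < A := by
    refine lt_of_le_of_lt ?_ (hgrad 0 h0)
    rw [KahlerBall.gradLengthSq_eq]
    exact hg.kahler.coForm_self_nonneg h0 _
  have hKA : K * A < n + 1 := by
    have := (lt_div_iff₀ hK).1 (EReal.coe_lt_coe_iff.1 hA2)
    linarith
  exact KahlerBall.not_forall_gradLengthSq_le hn hg hφ hA hKA fun z hz => (hgrad z hz).le
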